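/- **Setting.** An extended metric space is a nonempty set with a metric valued in $[0,\infty]$; "metric space" means finite-valued metric. $\mathcal M$ is the family of isometry classes of extended metric spaces. For $X,Y\in\mathcal M$ write $X\precsim Y$ if for all $x_1,\dots,x_N\in X$ there are $y_{i,k}\in Y$ $(1\le i\le N,\ k\ge1)$ with $d_X(x_i,x_j)\le\liminf_{k\to\infty}d_Y(y_{i,k},y_{j,k})$ for all $i,j$; write $X\sim Y$ if $X\precsim Y$ and $Y\precsim X$, and $[X]$ for the class of $X$. Let $\mathcal H$ be the Gromov–Hausdorff space of isometry classes of nonempty compact metric spaces, $\mathcal H(N,D)\subset\mathcal H$ the set of spaces with at most $N$ points and diameter at most $D$, and $\mathcal P_X=\{Z\in\mathcal H: Z\precsim X\}$. Put $$\rho(X,Y)=\sum_{N=1}^\infty 2^{-N}\, d_{\mathrm H}\big(\mathcal P_X\cap\mathcal H(N,N),\ \mathcal P_Y\cap\mathcal H(N,N)\big),$$ where $d_{\mathrm H}$ is the Hausdorff distance with respect to the Gromov–Hausdorff metric. For pointed extended metric spaces, $(X,x_0)\precsim(Y,y_0)$ is defined in the same way with indices $0,1,\dots,N$ and $y_{0,k}=y_0$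 for all $k$, and $\sim$ and $\rho((X,x_0),(Y,y_0))$ are defined in the same way with pointed compact metric spaces and the pointed Gromov–Hausdorff distance (the infimum of $d_{\mathrm H}(\varphi(X),\psi(Y))\vee d_Z(\varphi(x_0),\psi(y_0))$ over isometric embeddings $\varphi,\psi$ into compact metric spaces $Z$). Let $\mathcal G_0$ be the family of isometry classes of pointed geodesic metric spaces. With $B(x_0,r)$ the closed ball and $tX$ the space $X$ with metric $t\,d_X$, put $$\rho_0((X,x_0),(Y,y_0))=\int_0^\infty\rho\big((r^{-1}B(x_0,r),x_0),(r^{-1}B(y_0,r),y_0)\big)\,r e^{-r^2}\,dr$$ on $\mathcal G_0$, and write $(X,x_0)\simeq(Y,y_0)$ if $(B(x_0,r),x_0)\sim(B(y_0,r),y_0)$ for every $r>0$. A metric space is *geodesic* if any two of its points are joined by a minimal geodesic. It is *of Alexandrov curvature $\ge\kappa$* if it is a complete length space such that, for all points $p,x,y,z$ with $p\notin\{x,y,z\}$, the comparison angles in the model plane of constant curvature $\kappa$ satisfy $\tilde\angle_\kappa(p;x,y)+\tilde\angle_\kappa(p;y,z)+\tilde\angle_\kappa(p;z,x)\le2\pi$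 whenever they are defined (if $\kappa>0$: whenever the three triangles have perimeter $<2\pi/\sqrt\kappa$). It is *$\mathrm{CAT}(\kappa)$* if it is geodesic and in every geodesic triangle (of perimeter $<2\pi/\sqrt\kappa$ if $\kappa>0$) the distance between any two points on the sides is at most the distance between the corresponding points of the comparison triangle in the model plane of constant curvature $\kappa$. A class $[X]\in\mathcal M/{\sim}$, or $[(X,x_0)]\in\mathcal G_0/{\simeq}$, is said to have one of these three properties if it contains a metric space, respectively a pointed geodesic metric space, that has it. **Corollary.** Let $\kappa$ be a real number. 1. Let $X_n,X\in\mathcal M$ with $\rho(X_n,X)\to0$. If all $[X_n]$ are geodesic, then $[X]$ is geodesic. If all $[X_n]$ are of Alexandrov curvature $\ge\kappa$, then so is $[X]$. If all $[X_n]$ are $\mathrm{CAT}(\kappa)$, then so is $[X]$. 2. Let $(X_n,x_{0,n}),(X,x_0)\in\mathcal G_0$ with $\rho_0((X_n,x_{0,n}),(X,x_0))\to0$. Then the same three implications hold for the classes $[(X_n,x_{0,n})]$ and $[(X,x_0)]$ in $\mathcal G_0/{\simeq}$ (the one for "geodesic" being trivial). -/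

import Mathlib

open Filter Topology MeasureTheory GromovHausdorff
open scoped ENNReal

universe u v

namespace GHCompactification

/-! ### Extended metric spaces and the relations `≾`, `∼` -/

/-- A nonempty extended metric space, i.e. a member of the family `𝓜`
(everything below is invariant under isometries). -/
structure ExtMetricSpace : Type (u + 1) where
  carrier : Type u
  [emetric : EMetricSpace carrier]
  [nonempty : Nonempty carrier]

attribute [instance] ExtMetricSpace.emetric ExtMetricSpace.nonempty

/-- `X ≾ Y`: for each finite sequence `x₁, …, x_N` in `X` there are `y_{i,k} ∈ Y` with
`d(x_i, x_j) ≤ liminf_k d(y_{i,k}, y_{j,k})` for all `i, j`. -/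
def Precsim (X : Type u) (Y : Type v) [EMetricSpace X] [EMetricSpace Y] : Prop :=
  ∀ (N : ℕ) (x : Fin N → X), ∃ y : ℕ → Fin N → Y, ∀ i j : Fin N,
    edist (x i) (x j) ≤ liminf (fun k => edist (y k i) (y k j)) atTop

/-- The equivalence `X ∼ Y`. -/
def Sim (X : Type u) (Y : Type v) [EMetricSpace X] [EMetricSpace Y] : Prop :=
  Precsim X Y ∧ Precsim Y X

/-! ### The pseudometric `ρ` -/

/-- `𝓗(N, D)`: isometry classes of metric spaces with at most `N` points and diameter at
most `D`, as a subset of the Gromov-Hausdorff space. -/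
def finiteGH (N : ℕ) (D : ℝ) : Set GHSpace :=
  {p | Finite p.Rep ∧ Nat.card p.Rep ≤ N ∧ Metric.diam (Set.univ : Set p.Rep) ≤ D}

/-- `𝓟_X`: all compact metric spaces `Y` (up to isometry) with `Y ≾ X`. -/
def pyramid (X : ExtMetricSpace.{u}) : Set GHSpace :=
  {p | Precsim p.Rep X.carrier}

/-- `ρ_N(X, Y)`, the Hausdorff distance of `𝓟_X ∩ 𝓗(N, N)` and `𝓟_Y ∩ 𝓗(N, N)` with respect
to the Gromov-Hausdorff metric. -/
noncomputable def rhoN (N : ℕ) (X Y : ExtMetricSpace.{u}) : ℝ≥0∞ :=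
  Metric.hausdorffEDist (pyramid X ∩ finiteGH N N) (pyramid Y ∩ finiteGH N N)

/-- `ρ(X, Y) = ∑_{N ≥ 1} 2^{-N} ρ_N(X, Y)`. -/
noncomputable def rho (X Y : ExtMetricSpace.{u}) : ℝ≥0∞ :=
  ∑' N : ℕ, (2⁻¹ : ℝ≥0∞) ^ (N + 1) * rhoN (N + 1) X Y

/-! ### Pointed extended metric spaces and the pointed version of `ρ` -/

/-- A pointed extended metric space. -/
structure PointedExt : Type (u + 1) where
  carrier : Type u
  [emetric : EMetricSpace carrier]
  pt : carrier

attribute [instance] PointedExt.emetric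

/-- `(X, x₀) ≾ (Y, y₀)`; the index `0` stands for the base points. -/
def PrecsimPt {X : Type u} {Y : Type v} [EMetricSpace X] [EMetricSpace Y] (x₀ : X) (y₀ : Y) :
    Prop :=
  ∀ (N : ℕ) (x : Fin (N + 1) → X), x 0 = x₀ →
    ∃ y : ℕ → Fin (N + 1) → Y, (∀ k, y k 0 = y₀) ∧ ∀ i j : Fin (N + 1),
      edist (x i) (x j) ≤ liminf (fun k => edist (y k i) (y k j)) atTop

/-- The equivalence `(X, x₀) ∼ (Y, y₀)`. -/
def SimPt (P Q : PointedExt.{u}) : Prop :=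
  PrecsimPt P.pt Q.pt ∧ PrecsimPt Q.pt P.pt

/-- Pointed compact metric spaces: a class in the Gromov-Hausdorff space together with a point
of its representative.  Every pointed nonempty compact metric space is isometric to one of
these. -/
abbrev PointedCompact : Type :=
  Σ p : GHSpace, p.Rep

/-- The pointed Gromov-Hausdorff distance: the infimum of
`d_H(φ(X), ψ(Y)) ∨ d_Z(φ(x₀), ψ(y₀))` over all isometric embeddings `φ : X → Z`, `ψ : Y → Z`
into compact metric spaces `Z`. -/
noncomputable def pointedGHDist (p q : PointedCompact) : ℝ≥0∞ :=
  ⨅ (Z : Type) (_ : MetricSpace Z) (_ : CompactSpace Z) (φ : p.1.Rep → Z) (ψ : q.1.Rep → Z)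
    (_ : Isometry φ) (_ : Isometry ψ),
    max (Metric.hausdorffEDist (Set.range φ) (Set.range ψ)) (edist (φ p.2) (ψ q.2))

/-- The Hausdorff distance of two sets with respect to a distance function `d`. -/
noncomputable def hausdorffBy {α : Type v} (d : α → α → ℝ≥0∞) (A B : Set α) : ℝ≥0∞ :=
  max (⨆ a ∈ A, ⨅ b ∈ B, d a b) (⨆ b ∈ B, ⨅ a ∈ A, d b a)

/-- `𝓗₀(N, D)`. -/
def pointedFiniteGH (N : ℕ) (D : ℝ) : Set PointedCompact :=
  {p | p.1 ∈ finiteGH N D}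

/-- `𝓟_{(X, x₀)}`. -/
def pointedPyramid (P : PointedExt.{u}) : Set PointedCompact :=
  {p | PrecsimPt p.2 P.pt}

/-- `ρ_N((X, x₀), (Y, y₀))`. -/
noncomputable def rhoPtN (N : ℕ) (P Q : PointedExt.{u}) : ℝ≥0∞ :=
  hausdorffBy pointedGHDist (pointedPyramid P ∩ pointedFiniteGH N N)
    (pointedPyramid Q ∩ pointedFiniteGH N N)

/-- `ρ((X, x₀), (Y, y₀)) = ∑_{N ≥ 1} 2^{-N} ρ_N((X, x₀), (Y, y₀))`. -/
noncomputable def rhoPt (P Q : PointedExt.{u}) : ℝ≥0∞ :=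
  ∑' N : ℕ, (2⁻¹ : ℝ≥0∞) ^ (N + 1) * rhoPtN (N + 1) P Q

/-! ### Geodesic spaces, the pseudometric `ρ₀` and strong equivalence -/

/-- `γ`, restricted to `[0, d(x, y)]`, is a minimal geodesic from `x` to `y`, parametrized by
arc length. -/
def IsMinGeodesic {X : Type u} [MetricSpace X] (γ : ℝ → X) (x y : X) : Prop :=
  γ 0 = x ∧ γ (dist x y) = y ∧
    ∀ s ∈ Set.Icc 0 (dist x y), ∀ t ∈ Set.Icc 0 (dist x y), dist (γ s) (γ t) = |s - t|

/-- Any two points are joined by a minimal geodesic. -/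
def IsGeodesicSpace (X : Type u) [MetricSpace X] : Prop :=
  ∀ x y : X, ∃ γ : ℝ → X, IsMinGeodesic γ x y

/-- A pointed geodesic metric space, i.e. a member of the family `𝓖₀`. -/
structure PointedGeodesic : Type (u + 1) where
  carrier : Type u
  [metric : MetricSpace carrier]
  geodesic : IsGeodesicSpace carrier
  pt : carrier

attribute [instance] PointedGeodesic.metric

/-- The metric `t · d` for `t > 0`. -/
@[reducible]
def scaledMetric (t : ℝ) (ht : 0 < t) (X : Type u) [MetricSpace X] : MetricSpace X where
  dist x y := t * dist x y
  dist_self x := by simp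
  dist_comm x y := by simp [dist_comm]
  dist_triangle x y z := by
    rw [← mul_add]
    exact mul_le_mul_of_nonneg_left (_root_.dist_triangle x y z) ht.le
  eq_of_dist_eq_zero {x y} h := by
    rcases mul_eq_zero.mp h with h | h
    · exact absurd h ht.ne'
    · exact _root_.eq_of_dist_eq_zero h

/-- The pointed closed ball `(B(x₀, r), x₀)`. -/
def pointedBall (P : PointedGeodesic.{u}) (r : ℝ) (hr : 0 < r) : PointedExt.{u} where
  carrier := Metric.closedBall P.pt r
  pt := ⟨P.pt, Metric.mem_closedBall_self hr.le⟩

/-- The rescaled pointed closed ball `(r⁻¹ B(x₀, r), x₀)`. -/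
noncomputable def scaledBall (P : PointedGeodesic.{u}) (r : ℝ) (hr : 0 < r) : PointedExt.{u} where
  carrier := Metric.closedBall P.pt r
  emetric := (scaledMetric r⁻¹ (inv_pos.mpr hr) (Metric.closedBall P.pt r)).toEMetricSpace
  pt := ⟨P.pt, Metric.mem_closedBall_self hr.le⟩

/-- `ρ₀((X, x₀), (Y, y₀)) =
∫_{(0, ∞)} ρ((r⁻¹ B(x₀, r), x₀), (r⁻¹ B(y₀, r), y₀)) r e^{-r²} dr`. -/
noncomputable def rho₀ (P Q : PointedGeodesic.{u}) : ℝ≥0∞ :=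
  ∫⁻ r : Set.Ioi (0 : ℝ), rhoPt (scaledBall P r.1 r.2) (scaledBall Q r.1 r.2) *
    ENNReal.ofReal (r.1 * Real.exp (-r.1 ^ 2)) ∂(Measure.comap Subtype.val volume)

/-- Strong equivalence `(X, x₀) ≃ (Y, y₀)`. -/
def StrongEquiv (P Q : PointedGeodesic.{u}) : Prop :=
  ∀ (r : ℝ) (hr : 0 < r), SimPt (pointedBall P r hr) (pointedBall Q r hr)

/-! ### Comparison geometry -/

/-- The law of cosines in the model plane of constant curvature `κ`: the angle opposite to the
side of length `c` in a triangle with side lengths `a, b, c`. -/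
noncomputable def modelAngle (κ a b c : ℝ) : ℝ :=
  if 0 < κ then
    Real.arccos ((Real.cos (√κ * c) - Real.cos (√κ * a) * Real.cos (√κ * b)) /
      (Real.sin (√κ * a) * Real.sin (√κ * b)))
  else if κ = 0 then
    Real.arccos ((a ^ 2 + b ^ 2 - c ^ 2) / (2 * a * b))
  else
    Real.arccos ((Real.cosh (√(-κ) * a) * Real.cosh (√(-κ) * b) - Real.cosh (√(-κ) * c)) /
      (Real.sinh (√(-κ) * a) * Real.sinh (√(-κ) * b)))

/-- The law of cosines in the model plane of constant curvature `κ`: the distance of two points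
at distances `s` and `t` from a vertex, in directions that enclose the angle `α`. -/
noncomputable def modelSide (κ s t α : ℝ) : ℝ :=
  if 0 < κ then
    Real.arccos (Real.cos (√κ * s) * Real.cos (√κ * t) +
      Real.sin (√κ * s) * Real.sin (√κ * t) * Real.cos α) / √κ
  else if κ = 0 then
    √(s ^ 2 + t ^ 2 - 2 * s * t * Real.cos α)
  else
    Real.arcosh (Real.cosh (√(-κ) * s) * Real.cosh (√(-κ) * t) -
      Real.sinh (√(-κ) * s) * Real.sinh (√(-κ) * t) * Real.cos α) / √(-κ)

/-- The perimeter condition for the existence and uniqueness of a comparison triangle: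
`a + b + c < 2π/√κ` if `κ > 0`, and no condition if `κ ≤ 0`. -/
def SmallPerimeter (κ a b c : ℝ) : Prop :=
  0 < κ → a + b + c < 2 * Real.pi / √κ

/-- The distance of any two points is the infimum of the lengths of the curves joining them. -/
def IsLengthSpace (X : Type u) [MetricSpace X] : Prop :=
  ∀ x y : X, ∀ ε : ℝ, 0 < ε → ∃ γ : ℝ → X, ContinuousOn γ (Set.Icc 0 1) ∧ γ 0 = x ∧ γ 1 = y ∧
    eVariationOn γ (Set.Icc 0 1) ≤ ENNReal.ofReal (dist x y + ε)

/-- A space of Alexandrov curvature `≥ κ`: a complete length space in which the comparison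
angles of any quadruple `(p; x, y, z)` satisfy
`∠̃(p; x, y) + ∠̃(p; y, z) + ∠̃(p; z, x) ≤ 2π` as soon as all three are defined. -/
def IsAlexandrovGE (κ : ℝ) (X : Type u) [MetricSpace X] : Prop :=
  CompleteSpace X ∧ IsLengthSpace X ∧
    ∀ p x y z : X, p ≠ x → p ≠ y → p ≠ z →
      SmallPerimeter κ (dist p x) (dist p y) (dist x y) →
      SmallPerimeter κ (dist p y) (dist p z) (dist y z) →
      SmallPerimeter κ (dist p z) (dist p x) (dist z x) →
      modelAngle κ (dist p x) (dist p y) (dist x y) +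
        modelAngle κ (dist p y) (dist p z) (dist y z) +
        modelAngle κ (dist p z) (dist p x) (dist z x) ≤ 2 * Real.pi

/-- A `CAT(κ)` space: a geodesic metric space in which each geodesic triangle (of perimeter
`< 2π/√κ` if `κ > 0`) is not thicker than its comparison triangle in the model plane: the
distance of two points `γ s`, `δ t` on sides of the triangle is at most the distance of the
corresponding points on the comparison triangle.  Two different sides of a triangle have a
vertex in common, which is called `p` here. -/
def IsCAT (κ : ℝ) (X : Type u) [MetricSpace X] : Prop :=
  IsGeodesicSpace X ∧
    ∀ (p q r : X) (γ δ : ℝ → X), IsMinGeodesic γ p q → IsMinGeodesic δ p r →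
      SmallPerimeter κ (dist p q) (dist p r) (dist q r) →
      ∀ s ∈ Set.Icc 0 (dist p q), ∀ t ∈ Set.Icc 0 (dist p r),
        dist (γ s) (δ t) ≤
          modelSide κ s t (modelAngle κ (dist p q) (dist p r) (dist q r))

/-! ### Properties of equivalence classes -/

/-- A (non-extended) metric space belongs to the class `[X] ∈ 𝓜/∼`. -/
def MemClass (Y : Type u) [MetricSpace Y] (X : ExtMetricSpace.{u}) : Prop :=
  Nonempty Y ∧ Sim Y X.carrier

/-- `[X] ∈ 𝓜/∼` is geodesic: it contains a geodesic metric space. -/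
def ClassGeodesic (X : ExtMetricSpace.{u}) : Prop :=
  ∃ (Y : Type u) (_ : MetricSpace Y), MemClass Y X ∧ IsGeodesicSpace Y

/-- `[X] ∈ 𝓜/∼` is of Alexandrov curvature `≥ κ`. -/
def ClassAlexandrovGE (κ : ℝ) (X : ExtMetricSpace.{u}) : Prop :=
  ∃ (Y : Type u) (_ : MetricSpace Y), MemClass Y X ∧ IsAlexandrovGE κ Y

/-- `[X] ∈ 𝓜/∼` is `CAT(κ)`. -/
def ClassCAT (κ : ℝ) (X : ExtMetricSpace.{u}) : Prop :=
  ∃ (Y : Type u) (_ : MetricSpace Y), MemClass Y X ∧ IsCAT κ Y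

/-- `[(X, x₀)] ∈ 𝓖₀/≃` is geodesic (which holds for every class). -/
def PtClassGeodesic (P : PointedGeodesic.{u}) : Prop :=
  ∃ Q : PointedGeodesic.{u}, StrongEquiv Q P ∧ IsGeodesicSpace Q.carrier

/-- `[(X, x₀)] ∈ 𝓖₀/≃` is of Alexandrov curvature `≥ κ`. -/
def PtClassAlexandrovGE (κ : ℝ) (P : PointedGeodesic.{u}) : Prop :=
  ∃ Q : PointedGeodesic.{u}, StrongEquiv Q P ∧ IsAlexandrovGE κ Q.carrier

/-- `[(X, x₀)] ∈ 𝓖₀/≃` is `CAT(κ)`. -/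
def PtClassCAT (κ : ℝ) (P : PointedGeodesic.{u}) : Prop :=
  ∃ Q : PointedGeodesic.{u}, StrongEquiv Q P ∧ IsCAT κ Q.carrier

end GHCompactification

universe w

namespace GHCompactification

/-! ### The model functions -/

/-! Each property is closed under ultralimits of pointed metric spaces, and the limit class can be
represented by such an ultralimit of representatives `Z n` of the given classes.

The link with `rho` is domination of tuples. A tuple in `X`, with its distances truncated at `M`,
spans a finite space in `pyramid X ∩ finiteGH M M`. If `rhoN M X Y` is small, this space is
Gromov–Hausdorff close to one dominated by `Y`, so some tuple in `Y` dominates the original one up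
to a small error. As `Precsim` itself amounts to domination of truncated tuples with arbitrarily
small error, convergence in `rho` yields approximate domination in both directions
(`eventually_exists_tupleDom`).

Without base points there is a dichotomy along a free ultrafilter. If the diameters of the `Z n`
stay bounded, every sequence of points has a limit in the ultralimit, and dominations pass to the
limit (`sim_ultralimit`). Otherwise long almost minimal paths contain arbitrarily many points that
are arbitrarily far apart. Hence every space is dominated by the limit class, which is therefore the
class of the real line (`sim_real`), and the line has all three properties.

With base points no dichotomy arises, because only balls are compared. Small `rho₀` makes the balls
of some radius slightly above `r` close, and retracting along geodesics to the base point brings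
this down to `r` itself (`eventually_ballDom`, `BallDom.shrink`).

As to closedness under ultralimits, paths that are geodesic up to small errors converge to
geodesics, and an ultralimit is always complete. The quadruple condition passes to the limit by
continuity of comparison angles. For `CAT(κ)`, a geodesic of the ultralimit is not given as a limit
of geodesics; thin comparison triangles show that it is one (`tendsto_dist_geodesic`). -/

theorem SmallPerimeter.side_lt {κ a b c : ℝ} (h : SmallPerimeter κ a b c) (hκ : 0 < κ)
    (habc : a ≤ b + c) : √κ * a < Real.pi := by
  have h1 := h hκ
  have h2 : 0 < √κ := Real.sqrt_pos.mpr hκ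
  rw [lt_div_iff₀ h2] at h1
  nlinarith

theorem SmallPerimeter.swap {κ a b c : ℝ} (h : SmallPerimeter κ a b c) :
    SmallPerimeter κ b a c := fun hκ => by linarith [h hκ]

theorem eventually_smallPerimeter {ι : Type*} {l : Filter ι} {κ a b c : ℝ} {f g h : ι → ℝ}
    (hf : Tendsto f l (𝓝 a)) (hg : Tendsto g l (𝓝 b)) (hh : Tendsto h l (𝓝 c))
    (hs : SmallPerimeter κ a b c) : ∀ᶠ n in l, SmallPerimeter κ (f n) (g n) (h n) := by
  by_cases hκ : 0 < κ
  · filter_upwards [((hf.add hg).add hh).eventually_lt_const (hs hκ)] with n hn _ using hn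
  · exact Eventually.of_forall fun n h0 => absurd h0 hκ

/-- The triangle inequalities and the perimeter bound keep `√κ * a` and `√κ * b` below `π`, so the
denominator does not vanish in the limit. No such condition is needed along the sequence. -/
theorem tendsto_modelAngle {ι : Type*} {l : Filter ι} {κ a b c : ℝ} {f g h : ι → ℝ}
    (hf : Tendsto f l (𝓝 a)) (hg : Tendsto g l (𝓝 b)) (hh : Tendsto h l (𝓝 c))
    (ha : 0 < a) (hb : 0 < b) (hab : a ≤ b + c) (hba : b ≤ a + c)
    (hs : SmallPerimeter κ a b c) :
    Tendsto (fun n => modelAngle κ (f n) (g n) (h n)) l (𝓝 (modelAngle κ a b c)) := by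
  unfold modelAngle
  split_ifs with h1 h2
  · have h3 : 0 < √κ := Real.sqrt_pos.mpr h1
    have hA := Real.sin_pos_of_pos_of_lt_pi (mul_pos h3 ha) (hs.side_lt h1 hab)
    have hB := Real.sin_pos_of_pos_of_lt_pi (mul_pos h3 hb) (hs.swap.side_lt h1 hba)
    refine (Real.continuous_arccos.tendsto _).comp (Tendsto.div ?_ ?_ (mul_pos hA hB).ne')
    · exact ((Real.continuous_cos.tendsto _).comp (hh.const_mul _)).sub
        (((Real.continuous_cos.tendsto _).comp (hf.const_mul _)).mul
          ((Real.continuous_cos.tendsto _).comp (hg.const_mul _)))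
    · exact ((Real.continuous_sin.tendsto _).comp (hf.const_mul _)).mul
          ((Real.continuous_sin.tendsto _).comp (hg.const_mul _))
  · refine (Real.continuous_arccos.tendsto _).comp (Tendsto.div ?_ ?_ (by positivity))
    · exact ((hf.pow 2).add (hg.pow 2)).sub (hh.pow 2)
    · exact (hf.const_mul 2).mul hg
  · have h3 : 0 < √(-κ) := Real.sqrt_pos.mpr
      (neg_pos.mpr (lt_of_le_of_ne (not_lt.mp h1) h2))
    have hA := Real.sinh_pos_iff.mpr (mul_pos h3 ha)
    have hB := Real.sinh_pos_iff.mpr (mul_pos h3 hb)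
    refine (Real.continuous_arccos.tendsto _).comp (Tendsto.div ?_ ?_ (mul_pos hA hB).ne')
    · exact (((Real.continuous_cosh.tendsto _).comp (hf.const_mul _)).mul
          ((Real.continuous_cosh.tendsto _).comp (hg.const_mul _))).sub
        ((Real.continuous_cosh.tendsto _).comp (hh.const_mul _))
    · exact ((Real.continuous_sinh.tendsto _).comp (hf.const_mul _)).mul
          ((Real.continuous_sinh.tendsto _).comp (hg.const_mul _))

theorem one_le_hyperbolic_side {x y α : ℝ} (hx : 0 ≤ x) (hy : 0 ≤ y) :
    1 ≤ Real.cosh x * Real.cosh y - Real.sinh x * Real.sinh y * Real.cos α := by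
  have h1 := Real.one_le_cosh (x - y)
  rw [Real.cosh_sub] at h1
  have h2 : 0 ≤ Real.sinh x * Real.sinh y :=
    mul_nonneg (Real.sinh_nonneg_iff.mpr hx) (Real.sinh_nonneg_iff.mpr hy)
  nlinarith [Real.cos_le_one α]

/-- Continuity at `1` is two-sided: below `1` the square root has the default value `0`, and the
argument of the logarithm stays away from `0`. -/
theorem continuousAt_arcosh {x : ℝ} (hx : 1 ≤ x) : ContinuousAt Real.arcosh x := by
  unfold Real.arcosh
  have h : x + √(x ^ 2 - 1) ≠ 0 := by positivity
  fun_prop (disch := exact h)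

theorem tendsto_modelSide {ι : Type*} {l : Filter ι} {κ s t α : ℝ} {f g h : ι → ℝ}
    (hf : Tendsto f l (𝓝 s)) (hg : Tendsto g l (𝓝 t)) (hh : Tendsto h l (𝓝 α))
    (hs : 0 ≤ s) (ht : 0 ≤ t) :
    Tendsto (fun n => modelSide κ (f n) (g n) (h n)) l (𝓝 (modelSide κ s t α)) := by
  have hc := (Real.continuous_cos.tendsto _).comp hh
  unfold modelSide
  split_ifs with h1 h2
  · refine ((Real.continuous_arccos.tendsto _).comp (Tendsto.add ?_ ?_)).div_const _
    · exact ((Real.continuous_cos.tendsto _).comp (hf.const_mul _)).mul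
          ((Real.continuous_cos.tendsto _).comp (hg.const_mul _))
    · exact (((Real.continuous_sin.tendsto _).comp (hf.const_mul _)).mul
          ((Real.continuous_sin.tendsto _).comp (hg.const_mul _))).mul hc
  · exact (Real.continuous_sqrt.tendsto _).comp
      (((hf.pow 2).add (hg.pow 2)).sub (((hf.const_mul 2).mul hg).mul hc))
  · refine ((continuousAt_arcosh (one_le_hyperbolic_side (by positivity)
      (by positivity))).tendsto.comp (Tendsto.sub ?_ ?_)).div_const _
    · exact ((Real.continuous_cosh.tendsto _).comp (hf.const_mul _)).mul
          ((Real.continuous_cosh.tendsto _).comp (hg.const_mul _))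
    · exact (((Real.continuous_sinh.tendsto _).comp (hf.const_mul _)).mul
          ((Real.continuous_sinh.tendsto _).comp (hg.const_mul _))).mul hc

theorem modelAngle_eq_zero {κ a b c : ℝ} (ha : 0 < a) (hb : 0 < b) (hc : c = |a - b|)
    (hs : SmallPerimeter κ a b c) : modelAngle κ a b c = 0 := by
  have hab : a ≤ b + c := by linarith [le_abs_self (a - b)]
  have hba : b ≤ a + c := by linarith [neg_abs_le (a - b)]
  unfold modelAngle
  split_ifs with h1 h2
  · have h3 : 0 < √κ := Real.sqrt_pos.mpr h1
    have hA := Real.sin_pos_of_pos_of_lt_pi (mul_pos h3 ha) (hs.side_lt h1 hab)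
    have hB := Real.sin_pos_of_pos_of_lt_pi (mul_pos h3 hb) (hs.swap.side_lt h1 hba)
    have : Real.cos (√κ * c) = Real.cos (√κ * a - √κ * b) := by
      rw [← Real.cos_abs (√κ * a - √κ * b), ← mul_sub, abs_mul, abs_of_pos h3, hc]
    rw [this, Real.cos_sub, add_sub_cancel_left, div_self (mul_pos hA hB).ne', Real.arccos_one]
  · rw [hc, sq_abs, show a ^ 2 + b ^ 2 - (a - b) ^ 2 = 2 * a * b by ring,
      div_self (by positivity), Real.arccos_one]
  · have h3 : 0 < √(-κ) := Real.sqrt_pos.mpr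
      (neg_pos.mpr (lt_of_le_of_ne (not_lt.mp h1) h2))
    have hA := Real.sinh_pos_iff.mpr (mul_pos h3 ha)
    have hB := Real.sinh_pos_iff.mpr (mul_pos h3 hb)
    have : Real.cosh (√(-κ) * c) = Real.cosh (√(-κ) * a - √(-κ) * b) := by
      rw [← Real.cosh_abs (√(-κ) * a - √(-κ) * b), ← mul_sub, abs_mul, abs_of_pos h3, hc]
    rw [this, Real.cosh_sub, sub_sub_cancel, div_self (mul_pos hA hB).ne', Real.arccos_one]

theorem modelAngle_eq_pi {κ a b c : ℝ} (ha : 0 < a) (hb : 0 < b) (hc : c = a + b)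
    (hs : SmallPerimeter κ a b c) : modelAngle κ a b c = Real.pi := by
  unfold modelAngle
  split_ifs with h1 h2
  · have h3 : 0 < √κ := Real.sqrt_pos.mpr h1
    have hA := Real.sin_pos_of_pos_of_lt_pi (mul_pos h3 ha) (hs.side_lt h1 (by linarith))
    have hB := Real.sin_pos_of_pos_of_lt_pi (mul_pos h3 hb) (hs.swap.side_lt h1 (by linarith))
    rw [hc, mul_add, Real.cos_add, sub_sub_cancel_left, neg_div, div_self (mul_pos hA hB).ne',
      Real.arccos_neg_one]
  · rw [hc, show a ^ 2 + b ^ 2 - (a + b) ^ 2 = -(2 * a * b) by ring, neg_div,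
      div_self (by positivity), Real.arccos_neg_one]
  · have h3 : 0 < √(-κ) := Real.sqrt_pos.mpr
      (neg_pos.mpr (lt_of_le_of_ne (not_lt.mp h1) h2))
    have hA := Real.sinh_pos_iff.mpr (mul_pos h3 ha)
    have hB := Real.sinh_pos_iff.mpr (mul_pos h3 hb)
    rw [hc, mul_add, Real.cosh_add, sub_add_cancel_left, neg_div, div_self (mul_pos hA hB).ne',
      Real.arccos_neg_one]

/-- The value of `modelSide` when the law of cosines degenerates to an addition formula. -/
theorem modelSide_eq_of_degenerate {κ s t α x : ℝ} (hx : 0 ≤ x)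
    (hx' : 0 < κ → √κ * x ≤ Real.pi)
    (h : (x = |s - t| ∧ Real.cos α = 1) ∨ (x = |s + t| ∧ Real.cos α = -1)) :
    modelSide κ s t α = x := by
  unfold modelSide
  split_ifs with h1 h2
  · have h3 : 0 < √κ := Real.sqrt_pos.mpr h1
    rw [div_eq_iff h3.ne', mul_comm x, ← Real.arccos_cos (by positivity) (hx' h1)]
    congr 1
    rcases h with ⟨rfl, hc⟩ | ⟨rfl, hc⟩
    · rw [hc, mul_one, ← Real.cos_sub, ← mul_sub, ← Real.cos_abs, abs_mul, abs_of_pos h3]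
    · rw [hc, mul_neg_one, ← sub_eq_add_neg, ← Real.cos_add, ← mul_add, ← Real.cos_abs, abs_mul,
        abs_of_pos h3]
  · have : s ^ 2 + t ^ 2 - 2 * s * t * Real.cos α = x ^ 2 := by
      rcases h with ⟨rfl, hc⟩ | ⟨rfl, hc⟩ <;> rw [hc, sq_abs] <;> ring
    rw [this, Real.sqrt_sq hx]
  · have h3 : 0 < √(-κ) := Real.sqrt_pos.mpr
      (neg_pos.mpr (lt_of_le_of_ne (not_lt.mp h1) h2))
    rw [div_eq_iff h3.ne', mul_comm x, ← Real.arcosh_cosh (mul_nonneg h3.le hx)]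
    congr 1
    rcases h with ⟨rfl, hc⟩ | ⟨rfl, hc⟩
    · rw [hc, mul_one, ← Real.cosh_sub, ← mul_sub, ← Real.cosh_abs, abs_mul, abs_of_pos h3]
    · rw [hc, mul_neg_one, sub_neg_eq_add, ← Real.cosh_add, ← mul_add, ← Real.cosh_abs, abs_mul,
        abs_of_pos h3]

theorem modelSide_zero_left {κ t α : ℝ} (ht : 0 ≤ t) (ht' : 0 < κ → √κ * t ≤ Real.pi) :
    modelSide κ 0 t α = t := by
  have : modelSide κ 0 t α = modelSide κ 0 t 0 := by simp [modelSide]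
  rw [this]
  exact modelSide_eq_of_degenerate ht ht' (Or.inl ⟨by simp [abs_of_nonneg ht], Real.cos_zero⟩)

theorem modelSide_zero_right {κ s α : ℝ} (hs : 0 ≤ s) (hs' : 0 < κ → √κ * s ≤ Real.pi) :
    modelSide κ s 0 α = s := by
  have : modelSide κ s 0 α = modelSide κ s 0 0 := by simp [modelSide]
  rw [this]
  exact modelSide_eq_of_degenerate hs hs' (Or.inl ⟨by simp [abs_of_nonneg hs], Real.cos_zero⟩)

/-! ### The real line -/

theorem ulift_real_dist (x y : ULift.{u} ℝ) : dist x y = |x.down - y.down| := rfl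

theorem isGeodesicSpace_real : IsGeodesicSpace (ULift.{u} ℝ) := by
  intro x y
  rcases le_total x.down y.down with h | h
  · refine ⟨fun s => ⟨x.down + s⟩, ?_, ?_, ?_⟩
    · simp
    · ext; simp [ulift_real_dist, abs_of_nonpos (sub_nonpos.mpr h)]
    · intro s _ t _
      simp [Real.dist_eq]
  · refine ⟨fun s => ⟨x.down - s⟩, ?_, ?_, ?_⟩
    · simp
    · ext; simp [ulift_real_dist, abs_of_nonneg (sub_nonneg.mpr h)]
    · intro s _ t _
      rw [ulift_real_dist, sub_sub_sub_cancel_left, abs_sub_comm]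

theorem IsGeodesicSpace.isLengthSpace {X : Type u} [MetricSpace X] (h : IsGeodesicSpace X) :
    IsLengthSpace X := by
  intro x y ε hε
  obtain ⟨γ, h0, h1, hγ⟩ := h x y
  have hD : 0 ≤ dist x y := dist_nonneg
  have hm : ∀ t ∈ Set.Icc (0 : ℝ) 1, t * dist x y ∈ Set.Icc 0 (dist x y) := fun t ht =>
    ⟨mul_nonneg ht.1 hD, mul_le_of_le_one_left hD ht.2⟩
  have hL : LipschitzOnWith (nndist x y) (fun t => γ (t * dist x y)) (Set.Icc 0 1) := by
    refine LipschitzOnWith.of_dist_le_mul fun s hs t ht => ?_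
    rw [hγ _ (hm s hs) _ (hm t ht), ← sub_mul, abs_mul, abs_of_nonneg hD, Real.dist_eq,
      coe_nndist, mul_comm]
  refine ⟨fun t => γ (t * dist x y), hL.continuousOn, by simpa using h0, by simpa using h1, ?_⟩
  calc eVariationOn (fun t => γ (t * dist x y)) (Set.Icc 0 1)
      ≤ nndist x y * eVariationOn id (Set.Icc (0 : ℝ) 1) :=
        hL.comp_eVariationOn_le (g := id) (fun t ht => ht)
    _ ≤ nndist x y * 1 := by
        gcongr
        simp
    _ ≤ ENNReal.ofReal (dist x y + ε) := by
        rw [mul_one, ← edist_nndist, edist_dist]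
        exact ENNReal.ofReal_le_ofReal (by linarith)

theorem modelAngle_le_pi (κ a b c : ℝ) : modelAngle κ a b c ≤ Real.pi := by
  unfold modelAngle
  split_ifs <;> exact Real.arccos_le_pi _

theorem abs_sub_eq_of_mul_pos {p x y : ℝ} (h : 0 < (x - p) * (y - p)) :
    |x - y| = |(|p - x| - |p - y|)| := by
  rcases pos_and_pos_or_neg_and_neg_of_mul_pos h with ⟨h1, h2⟩ | ⟨h1, h2⟩
  · rw [abs_of_neg (by linarith : p - x < 0), abs_of_neg (by linarith : p - y < 0)]
    congr 1; ring
  · rw [abs_of_pos (by linarith : 0 < p - x), abs_of_pos (by linarith : 0 < p - y),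
      ← abs_neg (x - y)]
    congr 1; ring

/-- Two of the three points lie on the same side of `p`, so one angle is `0`; the other two are at
most `π`. -/
theorem isAlexandrovGE_real (κ : ℝ) : IsAlexandrovGE κ (ULift.{u} ℝ) := by
  refine ⟨inferInstance, isGeodesicSpace_real.isLengthSpace, ?_⟩
  have key : ∀ p x y : ULift.{u} ℝ, 0 < (x.down - p.down) * (y.down - p.down) →
      SmallPerimeter κ (dist p x) (dist p y) (dist x y) →
      modelAngle κ (dist p x) (dist p y) (dist x y) = 0 := by
    intro p x y h hs
    have hx : p ≠ x := fun e => by simp [e] at h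
    have hy : p ≠ y := fun e => by simp [e] at h
    exact modelAngle_eq_zero (dist_pos.mpr hx) (dist_pos.mpr hy) (abs_sub_eq_of_mul_pos h) hs
  intro p x y z hx hy hz h1 h2 h3
  have hd : ∀ w : ULift.{u} ℝ, p ≠ w → w.down - p.down ≠ 0 := fun w hw e =>
    hw (ULift.ext _ _ (by linarith))
  have b1 := modelAngle_le_pi κ (dist p x) (dist p y) (dist x y)
  have b2 := modelAngle_le_pi κ (dist p y) (dist p z) (dist y z)
  have b3 := modelAngle_le_pi κ (dist p z) (dist p x) (dist z x)
  rcases lt_or_gt_of_ne (hd x hx) with gx | gx <;> rcases lt_or_gt_of_ne (hd y hy) with gy | gy <;>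
    rcases lt_or_gt_of_ne (hd z hz) with gz | gz
  all_goals first
    | linarith [key p x y (mul_pos_of_neg_of_neg gx gy) h1]
    | linarith [key p x y (mul_pos gx gy) h1]
    | linarith [key p y z (mul_pos_of_neg_of_neg gy gz) h2]
    | linarith [key p y z (mul_pos gy gz) h2]
    | linarith [key p z x (mul_pos_of_neg_of_neg gz gx) h3]
    | linarith [key p z x (mul_pos gz gx) h3]

theorem IsMinGeodesic.dist_left {X : Type u} [MetricSpace X] {γ : ℝ → X} {x y : X}
    (h : IsMinGeodesic γ x y) {s : ℝ} (hs : s ∈ Set.Icc 0 (dist x y)) : dist x (γ s) = s := by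
  have := h.2.2 0 (Set.left_mem_Icc.mpr dist_nonneg) s hs
  rwa [h.1, zero_sub, abs_neg, abs_of_nonneg hs.1] at this

theorem IsMinGeodesic.dist_right {X : Type u} [MetricSpace X] {γ : ℝ → X} {x y : X}
    (h : IsMinGeodesic γ x y) {s : ℝ} (hs : s ∈ Set.Icc 0 (dist x y)) :
    dist (γ s) y = dist x y - s := by
  have := h.2.2 s hs _ (Set.right_mem_Icc.mpr dist_nonneg)
  rwa [h.2.1, abs_sub_comm, abs_of_nonneg (by linarith [hs.2])] at this

theorem IsMinGeodesic.down_eq {γ : ℝ → ULift.{u} ℝ} {p q : ULift.{u} ℝ}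
    (h : IsMinGeodesic γ p q) {s : ℝ} (hs : s ∈ Set.Icc 0 (dist p q)) :
    (p.down ≤ q.down → (γ s).down = p.down + s) ∧ (q.down ≤ p.down → (γ s).down = p.down - s) := by
  have h1 := h.dist_left hs
  have h2 := h.dist_right hs
  simp only [ulift_real_dist] at h1 h2
  constructor <;> intro hpq
  · rw [abs_of_nonpos (by linarith : p.down - q.down ≤ 0)] at h2
    rcases abs_cases (p.down - (γ s).down) with h3 | h3 <;>
      rcases abs_cases ((γ s).down - q.down) with h4 | h4 <;> linarith
  · rw [abs_of_nonneg (by linarith : 0 ≤ p.down - q.down)] at h2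
    rcases abs_cases (p.down - (γ s).down) with h3 | h3 <;>
      rcases abs_cases ((γ s).down - q.down) with h4 | h4 <;> linarith

theorem SmallPerimeter.side_le {κ a b c s : ℝ} (h : SmallPerimeter κ a b c)
    (habc : a ≤ b + c) (hs : s ≤ a) : 0 < κ → √κ * s ≤ Real.pi := fun hκ =>
  (mul_le_mul_of_nonneg_left hs (Real.sqrt_nonneg κ)).trans (h.side_lt hκ habc).le

/-- All triangles are degenerate: the angle at `p` is `0` or `π`, and the comparison distance equals
`|s - t|` or `s + t`, which is the actual distance. -/
theorem isCAT_real (κ : ℝ) : IsCAT κ (ULift.{u} ℝ) := by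
  refine ⟨isGeodesicSpace_real, ?_⟩
  intro p q r γ δ hγ hδ hsp s hs t ht
  have tr1 : dist p q ≤ dist p r + dist q r := by
    rw [dist_comm q r]; exact dist_triangle p r q
  have tr2 : dist p r ≤ dist p q + dist q r := dist_triangle p q r
  rcases eq_or_lt_of_le (dist_nonneg (x := p) (y := q)) with h0 | ha
  · obtain rfl : s = 0 := le_antisymm (h0 ▸ hs.2) hs.1
    rw [hγ.1, hδ.dist_left ht, modelSide_zero_left ht.1 (hsp.swap.side_le tr2 ht.2)]
  rcases eq_or_lt_of_le (dist_nonneg (x := p) (y := r)) with h0 | hb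
  · obtain rfl : t = 0 := le_antisymm (h0 ▸ ht.2) ht.1
    rw [hδ.1, dist_comm, hγ.dist_left hs, modelSide_zero_right hs.1 (hsp.side_le tr1 hs.2)]
  obtain ⟨g1, g2⟩ := hγ.down_eq hs
  obtain ⟨d1, d2⟩ := hδ.down_eq ht
  have hst : |s - t| ≤ max s t := abs_le.mpr
    ⟨by linarith [hs.1, le_max_right s t], by linarith [ht.1, le_max_left s t]⟩
  -- This keeps the distance in the range where `arccos` inverts `cos`.
  have hmax : 0 < κ → √κ * |s - t| ≤ Real.pi := fun hκ => by
    rcases le_total s t with h | h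
    · exact hsp.swap.side_le tr2 (hst.trans ((max_eq_right h).le.trans ht.2)) hκ
    · exact hsp.side_le tr1 (hst.trans ((max_eq_left h).le.trans hs.2)) hκ
  have hsame : 0 < (q.down - p.down) * (r.down - p.down) → |s - t| = modelSide κ s t
      (modelAngle κ (dist p q) (dist p r) (dist q r)) := fun h => by
    have hc : dist q r = |dist p q - dist p r| := abs_sub_eq_of_mul_pos h
    rw [modelAngle_eq_zero ha hb hc hsp, modelSide_eq_of_degenerate
      (abs_nonneg _) hmax (Or.inl ⟨rfl, Real.cos_zero⟩)]
  have hopp : dist q r = dist p q + dist p r → |s + t| = modelSide κ s t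
      (modelAngle κ (dist p q) (dist p r) (dist q r)) := fun h => by
    rw [modelAngle_eq_pi ha hb h hsp, modelSide_eq_of_degenerate
      (abs_nonneg _) (fun hκ => ?_) (Or.inr ⟨rfl, Real.cos_pi⟩)]
    have h1 := hsp hκ
    have h2 : 0 < √κ := Real.sqrt_pos.mpr hκ
    rw [lt_div_iff₀ h2] at h1
    rw [abs_of_nonneg (add_nonneg hs.1 ht.1)]
    nlinarith [hs.2, ht.2]
  rcases le_total p.down q.down with hq | hq <;> rcases le_total p.down r.down with hr | hr
  · rw [ulift_real_dist, g1 hq, d1 hr, add_sub_add_left_eq_sub]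
    refine (hsame (mul_pos ?_ ?_)).le
    · rwa [ulift_real_dist, abs_pos, ← abs_pos, abs_of_nonpos (by linarith), neg_sub] at ha
    · rwa [ulift_real_dist, abs_pos, ← abs_pos, abs_of_nonpos (by linarith), neg_sub] at hb
  · rw [ulift_real_dist, g1 hq, d2 hr, show p.down + s - (p.down - t) = s + t by ring]
    refine (hopp ?_).le
    simp only [ulift_real_dist]
    rw [abs_of_nonneg (by linarith), abs_of_nonpos (by linarith), abs_of_nonneg (by linarith)]
    ring
  · rw [ulift_real_dist, g2 hq, d1 hr, abs_sub_comm,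
      show p.down + t - (p.down - s) = s + t by ring]
    refine (hopp ?_).le
    simp only [ulift_real_dist]
    rw [abs_of_nonpos (by linarith), abs_of_nonneg (by linarith), abs_of_nonpos (by linarith)]
    ring
  · rw [ulift_real_dist, g2 hq, d2 hr, abs_sub_comm, sub_sub_sub_cancel_left]
    refine (hsame (mul_pos_of_neg_of_neg ?_ ?_)).le
    · rw [ulift_real_dist, abs_of_nonneg (by linarith)] at ha
      linarith
    · rw [ulift_real_dist, abs_of_nonneg (by linarith)] at hb
      linarith

/-! ### Ultralimits of pointed metric spaces -/

/-- Sequences that stay at bounded distance from the base points. -/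
structure BoundedSeq (Y : ℕ → Type u) [∀ n, MetricSpace (Y n)] (q : ∀ n, Y n) : Type u where
  val : ∀ n, Y n
  bounded : ∃ R : ℝ, ∀ᶠ n in (hyperfilter ℕ : Filter ℕ), dist (val n) (q n) ≤ R

section Ultralimit

variable {Y : ℕ → Type u} [∀ n, MetricSpace (Y n)] {q : ∀ n, Y n}

theorem BoundedSeq.exists_tendsto (f g : BoundedSeq Y q) :
    ∃ d, Tendsto (fun n => dist (f.val n) (g.val n)) (hyperfilter ℕ) (𝓝 d) := by
  obtain ⟨R, hR⟩ := f.bounded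
  obtain ⟨S, hS⟩ := g.bounded
  have h : ∀ᶠ n in (hyperfilter ℕ : Filter ℕ),
      dist (f.val n) (g.val n) ∈ Set.Icc (0 : ℝ) (R + S) := by
    filter_upwards [hR, hS] with n h1 h2
    exact ⟨dist_nonneg, (dist_triangle_right _ _ (q n)).trans (add_le_add h1 h2)⟩
  obtain ⟨d, -, hd⟩ := isCompact_Icc.ultrafilter_le_nhds'
    ((hyperfilter ℕ).map fun n => dist (f.val n) (g.val n)) h
  exact ⟨d, hd⟩

/-- The limit of the distances of two bounded sequences. -/
noncomputable def BoundedSeq.limDist (f g : BoundedSeq Y q) : ℝ := (f.exists_tendsto g).choose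

theorem BoundedSeq.tendsto_limDist (f g : BoundedSeq Y q) :
    Tendsto (fun n => dist (f.val n) (g.val n)) (hyperfilter ℕ) (𝓝 (f.limDist g)) :=
  (f.exists_tendsto g).choose_spec

noncomputable instance : PseudoMetricSpace (BoundedSeq Y q) where
  dist := BoundedSeq.limDist
  dist_self f := tendsto_nhds_unique (f.tendsto_limDist f) (by simp)
  dist_comm f g := tendsto_nhds_unique (f.tendsto_limDist g)
    (by simpa only [dist_comm] using g.tendsto_limDist f)
  dist_triangle f g h := le_of_tendsto_of_tendsto' (f.tendsto_limDist h)
    ((f.tendsto_limDist g).add (g.tendsto_limDist h)) fun _ => dist_triangle _ _ _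

/-- The ultralimit of the pointed metric spaces `(Y n, q n)`. -/
abbrev Ultralimit (Y : ℕ → Type u) [∀ n, MetricSpace (Y n)] (q : ∀ n, Y n) : Type u :=
  SeparationQuotient (BoundedSeq Y q)

/-- `IsLimit f x` says that the sequence `f` represents the point `x` of the ultralimit. -/
def IsLimit (f : ∀ n, Y n) (x : Ultralimit Y q) : Prop :=
  ∃ h, SeparationQuotient.mk (⟨f, h⟩ : BoundedSeq Y q) = x

theorem exists_isLimit (x : Ultralimit Y q) : ∃ f, IsLimit f x := by
  obtain ⟨f, rfl⟩ := SeparationQuotient.surjective_mk x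
  exact ⟨f.val, f.bounded, rfl⟩

theorem exists_isLimit_of_bounded (f : ∀ n, Y n) {R : ℝ}
    (h : ∀ᶠ n in (hyperfilter ℕ : Filter ℕ), dist (f n) (q n) ≤ R) :
    ∃ x : Ultralimit Y q, IsLimit f x :=
  ⟨_, ⟨R, h⟩, rfl⟩

theorem IsLimit.tendsto_dist {f g : ∀ n, Y n} {x y : Ultralimit Y q} (hf : IsLimit f x)
    (hg : IsLimit g y) :
    Tendsto (fun n => dist (f n) (g n)) (hyperfilter ℕ) (𝓝 (dist x y)) := by
  obtain ⟨h, rfl⟩ := hf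
  obtain ⟨h', rfl⟩ := hg
  exact BoundedSeq.tendsto_limDist (q := q) ⟨f, h⟩ ⟨g, h'⟩

theorem IsLimit.unique_of_tendsto {f g : ∀ n, Y n} {x y : Ultralimit Y q} (hf : IsLimit f x)
    (hg : IsLimit g y) (h : Tendsto (fun n => dist (f n) (g n)) (hyperfilter ℕ) (𝓝 0)) : x = y :=
  dist_eq_zero.mp (tendsto_nhds_unique (hf.tendsto_dist hg) h)

/-- The base point of the ultralimit. -/
noncomputable def Ultralimit.base (Y : ℕ → Type u) [∀ n, MetricSpace (Y n)] (q : ∀ n, Y n) :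
    Ultralimit Y q :=
  SeparationQuotient.mk ⟨q, 0, by simp⟩

theorem isLimit_base : IsLimit q (Ultralimit.base Y q) := ⟨_, rfl⟩

/-- A diagonal argument, which needs no completeness of the `Y n`: for a rapidly Cauchy sequence
with representatives `f k`, follow at index `n` the last `f k` with `k ≤ n` whose predecessors are
still as close to it as they are in the limit. -/
instance : CompleteSpace (Ultralimit Y q) := by
  refine Metric.complete_of_convergent_controlled_sequences (fun n => (1 / 2 : ℝ) ^ n)
    (by simp) fun u hu => ?_
  choose f hf using fun k => exists_isLimit (u k)
  let A : ℕ → ℕ → Prop := fun k n => ∀ i ≤ k, dist (f i n) (f k n) < (1 / 2 : ℝ) ^ i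
  let B : ℕ → ℕ → Prop := fun k n => k ≤ n ∧ A k n
  have hA : ∀ k, ∀ᶠ n in (hyperfilter ℕ : Filter ℕ), B k n := by
    intro k
    refine Eventually.and (Nat.hyperfilter_le_atTop (eventually_ge_atTop k)) ?_
    have : ∀ i ∈ Set.Iic k, ∀ᶠ n in (hyperfilter ℕ : Filter ℕ),
        dist (f i n) (f k n) < (1 / 2 : ℝ) ^ i := fun i hi =>
      ((hf i).tendsto_dist (hf k)).eventually_lt_const (hu i i k le_rfl hi)
    simpa [A] using (eventually_all_finite (Set.finite_Iic k)).mpr this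
  classical
  let K : ℕ → ℕ := fun n => Nat.findGreatest (fun k => A k n) n
  have hK : ∀ k n, B k n → dist (f k n) (f (K n) n) < (1 / 2 : ℝ) ^ k := by
    intro k n hk
    have h1 : k ≤ K n := Nat.le_findGreatest hk.1 hk.2
    have h2 : A (K n) n := Nat.findGreatest_spec (P := fun k => A k n) hk.1 hk.2
    exact h2 k h1
  obtain ⟨⟨R, hR⟩, -⟩ := hf 0
  obtain ⟨x, hx⟩ : ∃ x : Ultralimit Y q, IsLimit (fun n => f (K n) n) x := by
    refine exists_isLimit_of_bounded _ (R := 1 + R) ?_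
    filter_upwards [hR, hA 0] with n h1 h2
    have h3 := hK 0 n h2
    rw [pow_zero, dist_comm] at h3
    exact (dist_triangle _ _ _).trans (add_le_add h3.le h1)
  refine ⟨x, tendsto_iff_dist_tendsto_zero.mpr (squeeze_zero (fun _ => dist_nonneg) (fun k => ?_)
    (tendsto_pow_atTop_nhds_zero_of_lt_one (r := (1 / 2 : ℝ)) (by norm_num) (by norm_num)))⟩
  exact le_of_tendsto ((hf k).tendsto_dist hx) ((hA k).mono fun n hn => (hK k n hn).le)

/-- A metric space in which any two points are joined by paths that are minimal geodesics up to
an arbitrarily small error. -/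
def IsAlmostGeodesic (X : Type u) [MetricSpace X] : Prop :=
  ∀ x y : X, ∀ ε : ℝ, 0 < ε → ∃ γ : ℝ → X, γ 0 = x ∧ dist (γ (dist x y)) y ≤ ε ∧
    ∀ s ∈ Set.Icc 0 (dist x y), ∀ t ∈ Set.Icc 0 (dist x y),
      |s - t| ≤ dist (γ s) (γ t) ∧ dist (γ s) (γ t) ≤ |s - t| + ε

theorem IsGeodesicSpace.isAlmostGeodesic {X : Type u} [MetricSpace X] (h : IsGeodesicSpace X) :
    IsAlmostGeodesic X := by
  intro x y ε hε
  obtain ⟨γ, h0, h1, hγ⟩ := h x y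
  refine ⟨γ, h0, by simpa [h1] using hε.le, fun s hs t ht => ?_⟩
  rw [hγ s hs t ht]
  exact ⟨le_rfl, by linarith⟩

/-- A nearly shortest curve is reparametrized by the distance from `x`, using the intermediate value
theorem. Then `|s - t|` is an exact lower bound by the reverse triangle inequality, and the excess
length `ε` bounds the error from above. -/
theorem IsLengthSpace.isAlmostGeodesic {X : Type u} [MetricSpace X] (h : IsLengthSpace X) :
    IsAlmostGeodesic X := by
  intro x y ε hε
  obtain ⟨γ, hc, h0, h1, hl⟩ := h x y ε hε
  have hD : 0 ≤ dist x y := dist_nonneg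
  have hlen : ∀ a b, 0 ≤ a → a ≤ b → b ≤ 1 →
      dist x (γ a) + dist (γ a) (γ b) + dist (γ b) y ≤ dist x y + ε := by
    intro a b ha hab hb
    have e1 : eVariationOn γ (Set.Icc 0 1) = eVariationOn γ (Set.Icc 0 a) +
        eVariationOn γ (Set.Icc a b) + eVariationOn γ (Set.Icc b 1) := by
      have := eVariationOn.Icc_add_Icc γ (s := Set.univ) ha hab (Set.mem_univ a)
      have h2 := eVariationOn.Icc_add_Icc γ (s := Set.univ) (ha.trans hab) hb (Set.mem_univ b)
      simp only [Set.univ_inter] at this h2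
      rw [this, h2]
    have e2 : edist x (γ a) ≤ eVariationOn γ (Set.Icc 0 a) := h0 ▸ eVariationOn.edist_le γ
      (Set.left_mem_Icc.mpr ha) (Set.right_mem_Icc.mpr ha)
    have e3 : edist (γ a) (γ b) ≤ eVariationOn γ (Set.Icc a b) := eVariationOn.edist_le γ
      (Set.left_mem_Icc.mpr hab) (Set.right_mem_Icc.mpr hab)
    have e4 : edist (γ b) y ≤ eVariationOn γ (Set.Icc b 1) := h1 ▸ eVariationOn.edist_le γ
      (Set.left_mem_Icc.mpr hb) (Set.right_mem_Icc.mpr hb)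
    have e5 := (add_le_add (add_le_add e2 e3) e4).trans (e1 ▸ hl)
    rwa [edist_dist, edist_dist, edist_dist, ← ENNReal.ofReal_add dist_nonneg dist_nonneg,
      ← ENNReal.ofReal_add (add_nonneg dist_nonneg dist_nonneg) dist_nonneg,
      ENNReal.ofReal_le_ofReal_iff (by positivity)] at e5
  have hiv : ∀ s ∈ Set.Icc 0 (dist x y), ∃ τ ∈ Set.Icc (0 : ℝ) 1, dist x (γ τ) = s := by
    intro s hs
    have := intermediate_value_Icc (zero_le_one (α := ℝ)) (f := fun τ => dist x (γ τ))
      (by fun_prop)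
    simp only [h0, h1, dist_self] at this
    exact this hs
  choose! τ hτ hτd using hiv
  have hz : γ (τ 0) = x := (dist_eq_zero.mp (hτd 0 (Set.left_mem_Icc.mpr hD))).symm
  refine ⟨fun s => γ (τ s), hz, ?_, fun s hs t ht => ⟨?_, ?_⟩⟩
  · have hm := Set.right_mem_Icc.mpr hD
    have := hlen _ _ (hτ _ hm).1 le_rfl (hτ _ hm).2
    rw [hτd _ hm, dist_self] at this
    linarith
  · have := abs_dist_sub_le (γ (τ s)) (γ (τ t)) x
    rwa [dist_comm _ x, dist_comm _ x, hτd s hs, hτd t ht] at this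
  · have key : ∀ s ∈ Set.Icc 0 (dist x y), ∀ t ∈ Set.Icc 0 (dist x y), τ s ≤ τ t →
        dist (γ (τ s)) (γ (τ t)) ≤ |s - t| + ε := by
      intro s hs t ht hst
      have e1 := hlen _ _ (hτ _ hs).1 hst (hτ _ ht).2
      have e2 := dist_triangle x (γ (τ t)) y
      rw [hτd s hs] at e1
      rw [hτd t ht] at e2
      linarith [neg_abs_le (s - t)]
    -- The choice of `τ` need not be monotone, so both orders occur.
    rcases le_total (τ s) (τ t) with hst | hst
    · exact key s hs t ht hst
    · rw [dist_comm, abs_sub_comm]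
      exact key t ht s hs hst

theorem Ultralimit.isGeodesicSpace (h : ∀ n, IsAlmostGeodesic (Y n)) :
    IsGeodesicSpace (Ultralimit Y q) := by
  intro x y
  obtain ⟨f, hf⟩ := exists_isLimit x
  obtain ⟨g, hg⟩ := exists_isLimit y
  have hε : Tendsto (fun n : ℕ => 1 / ((n : ℝ) + 1)) (hyperfilter ℕ) (𝓝 0) :=
    tendsto_one_div_add_atTop_nhds_zero_nat.mono_left Nat.hyperfilter_le_atTop
  choose γ γ0 γ1 γd using fun n => h n (f n) (g n) (1 / ((n : ℝ) + 1)) Nat.one_div_pos_of_nat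
  have hD := hf.tendsto_dist hg
  -- The paths have lengths depending on `n`, so the parameter is clamped to the `n`-th interval;
  -- this is harmless in the limit.
  let c : ℝ → ℕ → ℝ := fun s n => max 0 (min s (dist (f n) (g n)))
  have hc : ∀ s n, c s n ∈ Set.Icc 0 (dist (f n) (g n)) := fun s n =>
    ⟨le_max_left _ _, max_le dist_nonneg (min_le_right _ _)⟩
  have hcl : ∀ s ∈ Set.Icc 0 (dist x y), Tendsto (c s) (hyperfilter ℕ) (𝓝 s) := by
    intro s hs
    have : Tendsto (c s) (hyperfilter ℕ) (𝓝 (max 0 (min s (dist x y)))) :=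
      tendsto_const_nhds.max (tendsto_const_nhds.min hD)
    rwa [min_eq_left hs.2, max_eq_right hs.1] at this
  have hex : ∀ s, ∃ z : Ultralimit Y q, IsLimit (fun n => γ n (c s n)) z := by
    intro s
    obtain ⟨⟨R, hR⟩, -⟩ := hf
    refine exists_isLimit_of_bounded _ (R := dist x y + 1 + 1 + R) ?_
    filter_upwards [hR, hD.eventually_le_const (lt_add_one _),
      hε.eventually_le_const zero_lt_one] with n h1 h2 h3
    have h4 := (γd n _ (hc s n) 0 (Set.left_mem_Icc.mpr dist_nonneg)).2
    rw [γ0, sub_zero, abs_of_nonneg (hc s n).1] at h4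
    linarith [dist_triangle (γ n (c s n)) (f n) (q n), (hc s n).2]
  choose z hz using hex
  refine ⟨z, ?_, ?_, fun s hs t ht => ?_⟩
  · refine (hz 0).unique_of_tendsto hf ?_
    have : ∀ n, c 0 n = 0 := fun n => by simp [c]
    simp [this, γ0]
  · refine (hz _).unique_of_tendsto hg (squeeze_zero (fun _ => dist_nonneg) (fun n => ?_)
      (?_ : Tendsto (fun n => |c (dist x y) n - dist (f n) (g n)| + 1 / ((n : ℝ) + 1) +
        1 / ((n : ℝ) + 1)) _ _))
    · have h4 := (γd n _ (hc (dist x y) n) _ (Set.right_mem_Icc.mpr dist_nonneg)).2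
      exact (dist_triangle _ _ _).trans (add_le_add h4 (γ1 n))
    · have := (((hcl _ (Set.right_mem_Icc.mpr dist_nonneg)).sub hD).abs.add hε).add hε
      simpa using this
  · have hst := ((hcl s hs).sub (hcl t ht)).abs
    refine tendsto_nhds_unique ((hz s).tendsto_dist (hz t))
      (tendsto_of_tendsto_of_tendsto_of_le_of_le hst (by simpa using hst.add hε)
        (fun n => (γd n _ (hc s n) _ (hc t n)).1) (fun n => (γd n _ (hc s n) _ (hc t n)).2))

/-- The hypotheses on a quadruple are open conditions, hence hold for almost all `n`; the angles are
continuous there and the conclusion is closed. -/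
theorem Ultralimit.isAlexandrovGE {κ : ℝ} (h : ∀ n, IsAlexandrovGE κ (Y n)) :
    IsAlexandrovGE κ (Ultralimit Y q) := by
  refine ⟨inferInstance, (Ultralimit.isGeodesicSpace fun n =>
    (h n).2.1.isAlmostGeodesic).isLengthSpace, ?_⟩
  intro p x y z hx hy hz h1 h2 h3
  obtain ⟨p', hp'⟩ := exists_isLimit p
  obtain ⟨x', hx'⟩ := exists_isLimit x
  obtain ⟨y', hy'⟩ := exists_isLimit y
  obtain ⟨z', hz'⟩ := exists_isLimit z
  have angle : ∀ {a b : Ultralimit Y q} {a' b' : ∀ n, Y n}, IsLimit a' a → IsLimit b' b →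
      p ≠ a → p ≠ b → SmallPerimeter κ (dist p a) (dist p b) (dist a b) →
      Tendsto (fun n => modelAngle κ (dist (p' n) (a' n)) (dist (p' n) (b' n))
        (dist (a' n) (b' n))) (hyperfilter ℕ)
        (𝓝 (modelAngle κ (dist p a) (dist p b) (dist a b))) :=
    fun {a b a' b'} ha hb hpa hpb hs =>
      tendsto_modelAngle (hp'.tendsto_dist ha) (hp'.tendsto_dist hb) (ha.tendsto_dist hb)
        (dist_pos.mpr hpa) (dist_pos.mpr hpb) (dist_triangle_right p a b |>.trans
          (by rw [dist_comm a b, dist_comm b a])) (dist_triangle p a b) hs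
  have ne : ∀ {a : Ultralimit Y q} {a' : ∀ n, Y n}, IsLimit a' a → p ≠ a →
      ∀ᶠ n in (hyperfilter ℕ : Filter ℕ), p' n ≠ a' n := fun ha hpa =>
    ((hp'.tendsto_dist ha).eventually_const_lt (dist_pos.mpr hpa)).mono fun n hn =>
      dist_pos.mp hn
  have small : ∀ {a b : Ultralimit Y q} {a' b' : ∀ n, Y n}, IsLimit a' a → IsLimit b' b →
      SmallPerimeter κ (dist p a) (dist p b) (dist a b) →
      ∀ᶠ n in (hyperfilter ℕ : Filter ℕ), SmallPerimeter κ (dist (p' n) (a' n))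
        (dist (p' n) (b' n)) (dist (a' n) (b' n)) := fun ha hb hs =>
    eventually_smallPerimeter (hp'.tendsto_dist ha) (hp'.tendsto_dist hb) (ha.tendsto_dist hb) hs
  refine le_of_tendsto (((angle hx' hy' hx hy h1).add (angle hy' hz' hy hz h2)).add
    (angle hz' hx' hz hx h3)) ?_
  filter_upwards [ne hx' hx, ne hy' hy, ne hz' hz, small hx' hy' h1, small hy' hz' h2,
    small hz' hx' h3] with n a1 a2 a3 a4 a5 a6
  exact (h n).2.2 _ _ _ _ a1 a2 a3 a4 a5 a6

/-- A point on a minimal geodesic in an ultralimit of `CAT(κ)` spaces is the limit of points on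
minimal geodesics. -/
theorem tendsto_dist_geodesic {κ : ℝ} (h : ∀ n, IsCAT κ (Y n)) {x y : Ultralimit Y q}
    {f g m : ∀ n, Y n} (hf : IsLimit f x) (hg : IsLimit g y) {γ : ℝ → Ultralimit Y q}
    (hγ : IsMinGeodesic γ x y) {η : ∀ n, ℝ → Y n} (hη : ∀ n, IsMinGeodesic (η n) (f n) (g n))
    {s : ℝ} (hs : s ∈ Set.Icc 0 (dist x y)) (hm : IsLimit m (γ s))
    (hκ : SmallPerimeter κ (dist x y) s (dist x y - s)) :
    Tendsto (fun n => dist (η n (min s (dist (f n) (g n)))) (m n)) (hyperfilter ℕ) (𝓝 0) := by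
  have hD := hf.tendsto_dist hg
  have hfm := hf.tendsto_dist hm
  have hgm := hg.tendsto_dist hm
  rw [hγ.dist_left hs] at hfm
  rw [dist_comm, hγ.dist_right hs] at hgm
  have hmin : ∀ n, min s (dist (f n) (g n)) ∈ Set.Icc 0 (dist (f n) (g n)) := fun n =>
    ⟨le_min hs.1 dist_nonneg, min_le_right _ _⟩
  rcases eq_or_lt_of_le hs.1 with rfl | hs0
  · simpa [min_eq_left dist_nonneg, (hη _).1] using hfm
  have hsl : Tendsto (fun n => min s (dist (f n) (g n))) (hyperfilter ℕ) (𝓝 s) := by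
    simpa [min_eq_left hs.2] using (tendsto_const_nhds (x := s)).min hD
  -- In the triangle `f n, g n, m n` the sides tend to `dist x y`, `s` and `dist x y - s`. It
  -- degenerates, so its comparison angle at `f n` tends to `0`, and `CAT(κ)` forces `m n`, the far
  -- end of `ζ n`, towards the point at parameter `s` on `η n`.
  choose ζ hζ using fun n => (h n).1 (f n) (m n)
  have hang := tendsto_modelAngle hD hfm hgm (hs0.trans_le hs.2) hs0 (by linarith)
    (by linarith [hs.2]) hκ
  rw [modelAngle_eq_zero (hs0.trans_le hs.2) hs0 (abs_of_nonneg (by linarith [hs.2])).symm hκ]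
    at hang
  have hside := tendsto_modelSide (κ := κ) hsl hfm hang hs.1 hs.1
  rw [modelSide_eq_of_degenerate le_rfl (fun _ => by simpa using Real.pi_pos.le)
    (Or.inl ⟨by simp, Real.cos_zero⟩)] at hside
  refine tendsto_of_tendsto_of_tendsto_of_le_of_le' tendsto_const_nhds hside
    (Eventually.of_forall fun _ => dist_nonneg) ?_
  filter_upwards [eventually_smallPerimeter hD hfm hgm hκ] with n hn
  have := (h n).2 (f n) (g n) (m n) (η n) (ζ n) (hη n) (hζ n) hn _ (hmin n) _
    (Set.right_mem_Icc.mpr dist_nonneg)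
  rwa [(hζ n).2.1] at this

/-- Both points are limits of points on geodesics in the `Y n`, where the comparison holds. The
perimeter condition for each side follows since twice a side is at most the perimeter. -/
theorem Ultralimit.isCAT {κ : ℝ} (h : ∀ n, IsCAT κ (Y n)) : IsCAT κ (Ultralimit Y q) := by
  refine ⟨Ultralimit.isGeodesicSpace fun n => (h n).1.isAlmostGeodesic, ?_⟩
  intro p x y γ δ hγ hδ hsp s hs t ht
  have tr1 : dist p x ≤ dist p y + dist x y := by
    rw [dist_comm x y]; exact dist_triangle p y x
  have tr2 : dist p y ≤ dist p x + dist x y := dist_triangle p x y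
  rcases eq_or_lt_of_le (dist_nonneg (x := p) (y := x)) with h0 | ha
  · obtain rfl : s = 0 := le_antisymm (h0 ▸ hs.2) hs.1
    rw [hγ.1, hδ.dist_left ht, modelSide_zero_left ht.1 (hsp.swap.side_le tr2 ht.2)]
  rcases eq_or_lt_of_le (dist_nonneg (x := p) (y := y)) with h0 | hb
  · obtain rfl : t = 0 := le_antisymm (h0 ▸ ht.2) ht.1
    rw [hδ.1, dist_comm, hγ.dist_left hs, modelSide_zero_right hs.1 (hsp.side_le tr1 hs.2)]
  obtain ⟨p', hp'⟩ := exists_isLimit p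
  obtain ⟨x', hx'⟩ := exists_isLimit x
  obtain ⟨y', hy'⟩ := exists_isLimit y
  obtain ⟨m, hm⟩ := exists_isLimit (γ s)
  obtain ⟨k, hk⟩ := exists_isLimit (δ t)
  choose η hη using fun n => (h n).1 (p' n) (x' n)
  choose θ hθ using fun n => (h n).1 (p' n) (y' n)
  have hA := hp'.tendsto_dist hx'
  have hB := hp'.tendsto_dist hy'
  have hC := hx'.tendsto_dist hy'
  have l1 := tendsto_dist_geodesic h hp' hx' hγ hη hs hm (fun hκ => by linarith [hsp hκ])
  have l2 := tendsto_dist_geodesic h hp' hy' hδ hθ ht hk (fun hκ => by linarith [hsp hκ])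
  have hsl : Tendsto (fun n => min s (dist (p' n) (x' n))) (hyperfilter ℕ) (𝓝 s) := by
    simpa [min_eq_left hs.2] using (tendsto_const_nhds (x := s)).min hA
  have htl : Tendsto (fun n => min t (dist (p' n) (y' n))) (hyperfilter ℕ) (𝓝 t) := by
    simpa [min_eq_left ht.2] using (tendsto_const_nhds (x := t)).min hB
  have hside := tendsto_modelSide (κ := κ) hsl htl
    (tendsto_modelAngle hA hB hC ha hb tr1 tr2 hsp) hs.1 ht.1
  have hsum := (l1.add l2).add hside
  rw [add_zero, zero_add] at hsum
  refine le_of_tendsto_of_tendsto (hm.tendsto_dist hk) hsum ?_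
  filter_upwards [eventually_smallPerimeter hA hB hC hsp] with n hn
  have e := (h n).2 _ _ _ _ _ (hη n) (hθ n) hn (min s (dist (p' n) (x' n)))
    ⟨le_min hs.1 dist_nonneg, min_le_right _ _⟩ (min t (dist (p' n) (y' n)))
    ⟨le_min ht.1 dist_nonneg, min_le_right _ _⟩
  have e2 := dist_triangle4 (m n) (η n (min s (dist (p' n) (x' n))))
    (θ n (min t (dist (p' n) (y' n)))) (k n)
  rw [dist_comm (m n) (η n _)] at e2
  linarith

end Ultralimit

/-! ### Approximate domination of tuples -/

/-- The distances within the tuple `x`, truncated at `R`, are at most those within `y`, up to an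
error `ε`. -/
def TupleDom {ι : Type*} {X : Type u} {Y : Type v} [EMetricSpace X] [EMetricSpace Y] (R ε : ℝ≥0∞)
    (x : ι → X) (y : ι → Y) : Prop :=
  ∀ i j, min (edist (x i) (x j)) R ≤ edist (y i) (y j) + ε

section TupleDom

variable {ι : Type*} {X : Type u} {Y : Type v} {Z : Type w} [EMetricSpace X] [EMetricSpace Y]
  [EMetricSpace Z] {R R' ε ε' : ℝ≥0∞} {x : ι → X} {y : ι → Y} {z : ι → Z}

/-- The truncation level is the same throughout: `min (a + ε) (R + ε) = min a R + ε`, so the second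
domination applies to the truncated distance. -/
theorem TupleDom.trans (h : TupleDom R ε x y) (h' : TupleDom R ε' y z) :
    TupleDom R (ε + ε') x z := fun i j =>
  calc min (edist (x i) (x j)) R ≤ min (edist (y i) (y j) + ε) (R + ε) :=
        le_min (h i j) ((min_le_right _ _).trans le_self_add)
    _ = min (edist (y i) (y j)) R + ε := min_add_add_right _ _ _
    _ ≤ edist (z i) (z j) + ε' + ε := by gcongr; exact h' i j
    _ = edist (z i) (z j) + (ε + ε') := by rw [add_assoc, add_comm ε']

theorem TupleDom.mono (h : TupleDom R ε x y) (hR : R' ≤ R) (hε : ε ≤ ε') : TupleDom R' ε' x y :=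
  fun i j => (min_le_min_left _ hR).trans ((h i j).trans (by gcongr))

theorem exists_tupleDom_of_le_liminf [Finite ι] {y : ℕ → ι → Y}
    (h : ∀ i j, edist (x i) (x j) ≤ liminf (fun k => edist (y k i) (y k j)) atTop)
    (hR : R ≠ ⊤) (hε : ε ≠ 0) : ∃ k, TupleDom R ε x (y k) := by
  have : ∀ i j, ∀ᶠ k in atTop, min (edist (x i) (x j)) R ≤ edist (y k i) (y k j) + ε := by
    intro i j
    rcases eq_or_ne (min (edist (x i) (x j)) R) 0 with h0 | h0
    · exact Eventually.of_forall fun k => h0 ▸ zero_le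
    · have h1 := ENNReal.sub_lt_self (ne_top_of_le_ne_top hR (min_le_right _ _)) h0 hε
      filter_upwards [eventually_lt_of_lt_liminf (h1.trans_le ((min_le_left _ _).trans (h i j)))]
        with k hk using tsub_le_iff_right.mp hk.le
  exact (eventually_all.mpr fun i => eventually_all.mpr (this i)).exists

theorem le_liminf_of_tupleDom {y : ℕ → ι → Y}
    (h : ∀ k : ℕ, TupleDom k ((k : ℝ≥0∞)⁻¹) x (y k)) (i j : ι) :
    edist (x i) (x j) ≤ liminf (fun k => edist (y k i) (y k j)) atTop := by
  refine le_of_forall_lt fun c hc => ?_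
  obtain ⟨c', hc', hc2⟩ := exists_between hc
  obtain ⟨c'', hc'', hc3⟩ := exists_between hc'
  refine hc''.trans_le (le_liminf_of_le (by isBoundedDefault) ?_)
  filter_upwards [ENNReal.tendsto_nat_nhds_top.eventually_const_lt (hc2.trans_le le_top),
    ENNReal.tendsto_inv_nat_nhds_zero.eventually_lt_const (tsub_pos_of_lt hc3)] with k h1 h2
  have h3 : c'' + (k : ℝ≥0∞)⁻¹ ≤ edist (y k i) (y k j) + (k : ℝ≥0∞)⁻¹ :=
    calc c'' + (k : ℝ≥0∞)⁻¹ ≤ c'' + (c' - c'') := by gcongr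
      _ = c' := add_tsub_cancel_of_le hc3.le
      _ ≤ min (edist (x i) (x j)) k := le_min hc2.le h1.le
      _ ≤ _ := h k i j
  exact (ENNReal.add_le_add_iff_right h2.ne_top).mp h3

end TupleDom

section Precsim

variable {X : Type u} {Y : Type v} [EMetricSpace X] [EMetricSpace Y]

theorem Precsim.exists_tupleDom (h : Precsim X Y) {N : ℕ} (x : Fin N → X) {R ε : ℝ≥0∞}
    (hR : R ≠ ⊤) (hε : ε ≠ 0) : ∃ y : Fin N → Y, TupleDom R ε x y := by
  obtain ⟨y, hy⟩ := h N x
  exact (exists_tupleDom_of_le_liminf hy hR hε).imp' y fun _ h => h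

/-- Truncating at `k` with error `1 / k` produces the sequence of tuples for the `liminf`. At `k =
0` the error is `⊤` and the condition is void. -/
theorem precsim_of_exists_tupleDom (h : ∀ (N : ℕ) (x : Fin N → X) (R ε : ℝ≥0∞), R ≠ ⊤ → ε ≠ 0 →
    ∃ y : Fin N → Y, TupleDom R ε x y) : Precsim X Y := by
  intro N x
  choose y hy using fun k : ℕ => h N x k (k : ℝ≥0∞)⁻¹ (ENNReal.natCast_ne_top k)
    (ENNReal.inv_ne_zero.mpr (ENNReal.natCast_ne_top k))
  exact ⟨y, le_liminf_of_tupleDom hy⟩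

theorem PrecsimPt.exists_tupleDom {x₀ : X} {y₀ : Y} (h : PrecsimPt x₀ y₀) {N : ℕ}
    (x : Fin (N + 1) → X) (hx : x 0 = x₀) {R ε : ℝ≥0∞} (hR : R ≠ ⊤) (hε : ε ≠ 0) :
    ∃ y : Fin (N + 1) → Y, y 0 = y₀ ∧ TupleDom R ε x y := by
  obtain ⟨y, hy0, hy⟩ := h N x hx
  obtain ⟨k, hk⟩ := exists_tupleDom_of_le_liminf hy hR hε
  exact ⟨y k, hy0 k, hk⟩

theorem precsimPt_of_exists_tupleDom {x₀ : X} {y₀ : Y}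
    (h : ∀ (N : ℕ) (x : Fin (N + 1) → X), x 0 = x₀ → ∀ R ε : ℝ≥0∞, R ≠ ⊤ → ε ≠ 0 →
      ∃ y : Fin (N + 1) → Y, y 0 = y₀ ∧ TupleDom R ε x y) : PrecsimPt x₀ y₀ := by
  intro N x hx
  choose y hy0 hy using fun k : ℕ => h N x hx k (k : ℝ≥0∞)⁻¹ (ENNReal.natCast_ne_top k)
    (ENNReal.inv_ne_zero.mpr (ENNReal.natCast_ne_top k))
  exact ⟨y, hy0, le_liminf_of_tupleDom hy⟩

end Precsim

/-! ### Finite spaces spanned by tuples -/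

/-- The index type of a tuple, with the distances of the tuple truncated at `M`. -/
structure TruncTuple {ι : Type w} {X : Type u} [EMetricSpace X] (_ : ι → X) (_ : ℕ) : Type w where
  idx : ι

noncomputable instance {ι : Type w} {X : Type u} [EMetricSpace X] (x : ι → X) (M : ℕ) :
    PseudoMetricSpace (TruncTuple x M) where
  dist i j := (min (edist (x i.idx) (x j.idx)) M).toReal
  dist_self i := by simp
  dist_comm i j := by rw [edist_comm]
  dist_triangle i j k := by
    have hM : ∀ a : ℝ≥0∞, min a M ≠ ⊤ := fun a =>
      ne_top_of_le_ne_top (ENNReal.natCast_ne_top M) (min_le_right _ _)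
    rw [← ENNReal.toReal_add (hM _) (hM _)]
    refine ENNReal.toReal_mono (ENNReal.add_ne_top.mpr ⟨hM _, hM _⟩) ?_
    rcases le_total (edist (x i.idx) (x j.idx)) M with h1 | h1
    · rcases le_total (edist (x j.idx) (x k.idx)) M with h2 | h2
      · rw [min_eq_left h1, min_eq_left h2]
        exact (min_le_left _ _).trans (edist_triangle _ _ _)
      · rw [min_eq_right h2]
        exact (min_le_right _ _).trans le_add_self
    · rw [min_eq_right h1]
      exact (min_le_right _ _).trans le_self_add

theorem TruncTuple.edist_eq {ι : Type w} {X : Type u} [EMetricSpace X] (x : ι → X) (M : ℕ)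
    (i j : TruncTuple x M) : edist i j = min (edist (x i.idx) (x j.idx)) M := by
  rw [edist_dist]
  exact ENNReal.ofReal_toReal
    (ne_top_of_le_ne_top (ENNReal.natCast_ne_top M) (min_le_right _ _))

theorem exists_finiteGH_of_tuple {X : Type u} [EMetricSpace X] {N M : ℕ} (hN : 0 < N)
    (hM : N ≤ M) (x : Fin N → X) : ∃ p ∈ finiteGH M M, ∃ φ : Fin N → p.Rep,
      Function.Surjective φ ∧ ∀ i j, edist (φ i) (φ j) = min (edist (x i) (x j)) M := by
  let S := SeparationQuotient (TruncTuple x M)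
  let mk : Fin N → S := fun i => SeparationQuotient.mk (⟨i⟩ : TruncTuple x M)
  have hmk : Function.Surjective mk :=
    SeparationQuotient.surjective_mk.comp fun i : TruncTuple x M => ⟨i.idx, rfl⟩
  have hS : Finite S := Finite.of_surjective mk hmk
  have : Nonempty S := ⟨mk ⟨0, hN⟩⟩
  obtain ⟨e⟩ := toGHSpace_eq_toGHSpace_iff_isometryEquiv.mp (GHSpace.toGHSpace_rep (toGHSpace S))
  have hφ : Function.Surjective (e.symm ∘ mk) := e.symm.surjective.comp hmk
  have hed : ∀ i j, edist ((e.symm ∘ mk) i) ((e.symm ∘ mk) j) = min (edist (x i) (x j)) M := by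
    intro i j
    rw [Function.comp, Function.comp, e.symm.edist_eq, edist_dist]
    exact (edist_dist (⟨i⟩ : TruncTuple x M) ⟨j⟩).symm.trans (TruncTuple.edist_eq x M _ _)
  refine ⟨toGHSpace S, ⟨Finite.of_surjective _ hφ, ?_, ?_⟩, e.symm ∘ mk, hφ, hed⟩
  · exact (Nat.card_le_card_of_surjective _ hφ).trans (by simpa using hM)
  · refine Metric.diam_le_of_forall_dist_le (Nat.cast_nonneg M) fun a _ b _ => ?_
    obtain ⟨i, rfl⟩ := hφ a
    obtain ⟨j, rfl⟩ := hφ b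
    rw [dist_edist, hed]
    simpa using ENNReal.toReal_mono (ENNReal.natCast_ne_top M)
      (min_le_right (edist (x i) (x j)) M)

/-! ### From small `rho` to domination of tuples -/

theorem exists_edist_lt_of_range {A B Z : Type*} [EMetricSpace Z] {Φ : A → Z} {Ψ : B → Z}
    {δ : ℝ≥0∞} (h : Metric.hausdorffEDist (Set.range Φ) (Set.range Ψ) < δ) (a : A) :
    ∃ b, edist (Φ a) (Ψ b) < δ := by
  obtain ⟨_, ⟨b, rfl⟩, hb⟩ := Metric.exists_edist_lt_of_hausdorffEDist_lt (Set.mem_range_self a) h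
  exact ⟨b, hb⟩

theorem tupleDom_of_edist_lt {ι A B Z : Type*} [EMetricSpace A] [EMetricSpace B] [EMetricSpace Z]
    {Φ : A → Z} {Ψ : B → Z} (hΦ : Isometry Φ) (hΨ : Isometry Ψ) {δ : ℝ≥0∞} {a : ι → A} {b : ι → B}
    (h : ∀ i, edist (Φ (a i)) (Ψ (b i)) < δ) (R : ℝ≥0∞) : TupleDom R (2 * δ) a b := by
  intro i j
  refine (min_le_left _ _).trans ?_
  rw [← hΦ.edist_eq, ← hΨ.edist_eq]
  calc edist (Φ (a i)) (Φ (a j))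
      ≤ edist (Φ (a i)) (Ψ (b i)) + edist (Ψ (b i)) (Ψ (b j)) + edist (Ψ (b j)) (Φ (a j)) :=
        edist_triangle4 _ _ _ _
    _ ≤ δ + edist (Ψ (b i)) (Ψ (b j)) + δ := by
        gcongr
        · exact (h i).le
        · rw [edist_comm]; exact (h j).le
    _ = edist (Ψ (b i)) (Ψ (b j)) + 2 * δ := by ring

theorem exists_tupleDom_of_rhoN_lt {X Y : ExtMetricSpace.{u}} {N M : ℕ} (hN : 0 < N) (hM : N ≤ M)
    {δ : ℝ≥0∞} (h : rhoN M X Y < δ) (x : Fin N → X.carrier) :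
    ∃ y : Fin N → Y.carrier, TupleDom M (3 * δ) x y := by
  obtain ⟨p, hp, φ, hφ, hed⟩ := exists_finiteGH_of_tuple hN hM x
  have hpX : p ∈ pyramid X := by
    intro K z
    obtain ⟨ψ, hψ⟩ := hφ.hasRightInverse
    refine ⟨fun _ i => x (ψ (z i)), fun i j => ?_⟩
    rw [liminf_const, ← hψ (z i), ← hψ (z j), hed, hψ, hψ]
    exact min_le_left _ _
  obtain ⟨q, hq, hpq⟩ := Metric.exists_edist_lt_of_hausdorffEDist_lt (Set.mem_inter hpX hp) h
  obtain ⟨Φ, Ψ, hΦ, hΨ, hd⟩ := ghDist_eq_hausdorffDist p.Rep q.Rep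
  have hfin : Metric.hausdorffEDist (Set.range Φ) (Set.range Ψ) ≠ ⊤ :=
    Metric.hausdorffEDist_ne_top_of_nonempty_of_bounded (Set.range_nonempty _)
      (Set.range_nonempty _) (isCompact_range hΦ.continuous).isBounded
      (isCompact_range hΨ.continuous).isBounded
  rw [edist_dist, dist_ghDist, hd, Metric.hausdorffDist, ENNReal.ofReal_toReal hfin] at hpq
  choose f hf using exists_edist_lt_of_range hpq
  obtain ⟨y, hy⟩ := hq.1.exists_tupleDom (fun i => f (φ i)) (ENNReal.natCast_ne_top M)
    (hpq.bot_lt.ne')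
  have h1 : TupleDom M 0 x φ := fun i j => by rw [add_zero, hed]
  have h2 := tupleDom_of_edist_lt hΦ hΨ (fun i => hf (φ i)) M
  -- No error from `x` to the finite space, `2 * δ` from the Gromov–Hausdorff approximation, `δ`
  -- from `q` to `Y`.
  refine ⟨y, ((h1.trans h2).trans hy).mono le_rfl (le_of_eq ?_)⟩
  ring

theorem exists_lt_of_hausdorffBy_lt {α : Type v} {d : α → α → ℝ≥0∞} {A B : Set α} {δ : ℝ≥0∞}
    (h : hausdorffBy d A B < δ) {a : α} (ha : a ∈ A) : ∃ b ∈ B, d a b < δ := by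
  have h1 : ⨅ b ∈ B, d a b < δ :=
    (le_iSup₂ (f := fun a _ => ⨅ b ∈ B, d a b) a ha).trans_lt ((le_max_left _ _).trans_lt h)
  simpa only [iInf_lt_iff, exists_prop] using h1

theorem exists_tupleDom_of_rhoPtN_lt {P Q : PointedExt.{u}} {N M : ℕ} (hM : N + 1 ≤ M)
    {δ : ℝ≥0∞} (h : rhoPtN M P Q < δ) (x : Fin (N + 1) → P.carrier) (hx : x 0 = P.pt) :
    ∃ y : Fin (N + 1) → Q.carrier, y 0 = Q.pt ∧ TupleDom M (3 * δ) x y := by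
  obtain ⟨p, hp, φ, hφ, hed⟩ := exists_finiteGH_of_tuple N.succ_pos hM x
  have hpP : (⟨p, φ 0⟩ : PointedCompact) ∈ pointedPyramid P := by
    intro K z hz
    obtain ⟨ψ, hψ⟩ := hφ.hasRightInverse
    refine ⟨fun _ i => x (ψ (z i)), fun _ => ?_, fun i j => ?_⟩
    · have h0 := hed (ψ (z 0)) 0
      rw [hψ, hz, edist_self, eq_comm] at h0
      change x (ψ (z 0)) = _
      rw [← hx, hz]
      -- Truncation at `M > 0` identifies no distinct points.
      refine edist_eq_zero.mp ((min_eq_bot.mp h0).resolve_right ?_)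
      exact Nat.cast_ne_zero.mpr (by omega : M ≠ 0)
    · rw [liminf_const, ← hψ (z i), ← hψ (z j), hed, hψ, hψ]
      exact min_le_left _ _
  obtain ⟨q, hq, hpq⟩ := exists_lt_of_hausdorffBy_lt h (Set.mem_inter hpP hp)
  simp only [pointedGHDist, iInf_lt_iff] at hpq
  obtain ⟨Z, _, _, Φ, Ψ, hΦ, hΨ, hd⟩ := hpq
  rw [max_lt_iff] at hd
  -- The base point has to go exactly to the base point, which the pointed distance allows.
  have hf : ∀ a, ∃ b, edist (Φ a) (Ψ b) < δ ∧ (a = φ 0 → b = q.2) := by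
    intro a
    by_cases ha : a = φ 0
    · exact ⟨q.2, ha ▸ hd.2, fun _ => rfl⟩
    · obtain ⟨b, hb⟩ := exists_edist_lt_of_range hd.1 a
      exact ⟨b, hb, fun h => absurd h ha⟩
  choose f hf hf0 using hf
  obtain ⟨y, hy0, hy⟩ := PrecsimPt.exists_tupleDom hq.1 (fun i => f (φ i)) (hf0 _ rfl)
    (ENNReal.natCast_ne_top M) (hd.2.bot_lt.ne')
  have h1 : TupleDom M 0 x φ := fun i j => by rw [add_zero, hed]
  have h2 := tupleDom_of_edist_lt hΦ hΨ (fun i => hf (φ i)) M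
  refine ⟨y, hy0, ((h1.trans h2).trans hy).mono le_rfl (le_of_eq ?_)⟩
  ring

theorem rhoN_comm (N : ℕ) (X Y : ExtMetricSpace.{u}) : rhoN N X Y = rhoN N Y X :=
  Metric.hausdorffEDist_comm

theorem rhoPtN_comm (N : ℕ) (P Q : PointedExt.{u}) : rhoPtN N P Q = rhoPtN N Q P :=
  max_comm _ _

theorem rhoN_lt_of_rho_lt {X Y : ExtMetricSpace.{u}} {N : ℕ} {δ : ℝ≥0∞}
    (h : rho X Y < 2⁻¹ ^ (N + 1) * δ) : rhoN (N + 1) X Y < δ :=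
  lt_of_mul_lt_mul_left'
    ((ENNReal.le_tsum (f := fun N => (2⁻¹ : ℝ≥0∞) ^ (N + 1) * rhoN (N + 1) X Y) N).trans_lt h)

theorem rhoPtN_lt_of_rhoPt_lt {P Q : PointedExt.{u}} {N : ℕ} {δ : ℝ≥0∞}
    (h : rhoPt P Q < 2⁻¹ ^ (N + 1) * δ) : rhoPtN (N + 1) P Q < δ :=
  lt_of_mul_lt_mul_left'
    ((ENNReal.le_tsum (f := fun N => (2⁻¹ : ℝ≥0∞) ^ (N + 1) * rhoPtN (N + 1) P Q) N).trans_lt h)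

theorem eventually_exists_tupleDom {X : ℕ → ExtMetricSpace.{u}} {Y : ExtMetricSpace.{u}}
    (h : Tendsto (fun n => rho (X n) Y) atTop (𝓝 0)) (N : ℕ) {R ε : ℝ≥0∞} (hR : R ≠ ⊤)
    (hε : ε ≠ 0) : ∀ᶠ n in atTop,
      (∀ x : Fin N → (X n).carrier, ∃ y : Fin N → Y.carrier, TupleDom R ε x y) ∧
      ∀ y : Fin N → Y.carrier, ∃ x : Fin N → (X n).carrier, TupleDom R ε y x := by
  obtain ⟨k, hk⟩ := ENNReal.exists_nat_gt hR
  -- The level must accommodate both the number of points and the truncation at `R`.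
  let m := max N k
  have hδ : 0 < (2⁻¹ : ℝ≥0∞) ^ (m + 1) * (ε / 3) :=
    ENNReal.mul_pos (pow_ne_zero _ (by simp)) (by simp [hε])
  have h3 : 3 * (ε / 3) = ε := ENNReal.mul_div_cancel (by simp) (by simp)
  have hRm : R ≤ ((m + 1 : ℕ) : ℝ≥0∞) := hk.le.trans
    (by exact_mod_cast (le_max_right N k).trans (Nat.le_succ _))
  filter_upwards [h.eventually_lt_const hδ] with n hn
  have hn' := rhoN_lt_of_rho_lt hn
  rcases N.eq_zero_or_pos with rfl | hN
  · exact ⟨fun x => ⟨Fin.elim0, fun i => i.elim0⟩, fun x => ⟨Fin.elim0, fun i => i.elim0⟩⟩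
  have hNm : N ≤ m + 1 := (le_max_left N k).trans (Nat.le_succ _)
  constructor
  · intro x
    obtain ⟨y, hy⟩ := exists_tupleDom_of_rhoN_lt hN hNm hn' x
    exact ⟨y, hy.mono hRm h3.le⟩
  · intro x
    rw [rhoN_comm] at hn'
    obtain ⟨y, hy⟩ := exists_tupleDom_of_rhoN_lt hN hNm hn' x
    exact ⟨y, hy.mono hRm h3.le⟩

/-! ### Limits of classes in `𝓜/∼` -/

theorem Precsim.of_eventually {X : ℕ → ExtMetricSpace.{u}} {Y : ExtMetricSpace.{u}}
    {W : Type v} [EMetricSpace W] (h : Tendsto (fun n => rho (X n) Y) atTop (𝓝 0))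
    {Z : ℕ → Type u} [∀ n, MetricSpace (Z n)] (hZ : ∀ n, MemClass (Z n) (X n))
    (hW : ∀ (N : ℕ) (x : Fin N → W) (R ε : ℝ≥0∞), R ≠ ⊤ → ε ≠ 0 →
      ∃ᶠ n in atTop, ∃ y : Fin N → Z n, TupleDom R ε x y) : Precsim W Y.carrier := by
  refine precsim_of_exists_tupleDom fun N x R ε hR hε => ?_
  have hε3 : ε / 3 ≠ 0 := by simp [hε]
  obtain ⟨n, ⟨z, hz⟩, h1, -⟩ := ((hW N x R (ε / 3) hR hε3).and_eventually
    (eventually_exists_tupleDom h N hR hε3)).exists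
  obtain ⟨w, hw⟩ := (hZ n).2.1.exists_tupleDom z hR hε3
  obtain ⟨y, hy⟩ := h1 w
  exact ⟨y, ((hz.trans hw).trans hy).mono le_rfl (ENNReal.add_thirds ε).le⟩

theorem eventually_exists_tupleDom_memClass {X : ℕ → ExtMetricSpace.{u}} {Y : ExtMetricSpace.{u}}
    (h : Tendsto (fun n => rho (X n) Y) atTop (𝓝 0))
    {Z : ℕ → Type u} [∀ n, MetricSpace (Z n)] (hZ : ∀ n, MemClass (Z n) (X n)) (N : ℕ)
    {R ε : ℝ≥0∞} (hR : R ≠ ⊤) (hε : ε ≠ 0) :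
    ∀ᶠ n in atTop, ∀ y : Fin N → Y.carrier, ∃ z : Fin N → Z n, TupleDom R ε y z := by
  have hε2 : ε / 2 ≠ 0 := by simp [hε]
  filter_upwards [eventually_exists_tupleDom h N hR hε2] with n hn y
  obtain ⟨x, hx⟩ := hn.2 y
  obtain ⟨z, hz⟩ := (hZ n).2.2.exists_tupleDom x hR hε2
  exact ⟨z, (hx.trans hz).mono le_rfl (ENNReal.add_halves ε).le⟩

/-- The diameter bound makes every sequence of points bounded, so the choice of `q` is immaterial
and dominating tuples in the `Z n` have limits. -/
theorem sim_ultralimit {X : ℕ → ExtMetricSpace.{u}} {Y : ExtMetricSpace.{u}}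
    (h : Tendsto (fun n => rho (X n) Y) atTop (𝓝 0))
    {Z : ℕ → Type u} [∀ n, MetricSpace (Z n)] (hZ : ∀ n, MemClass (Z n) (X n)) {R : ℝ}
    (hR : ∀ᶠ n in (hyperfilter ℕ : Filter ℕ), ∀ x y : Z n, dist x y ≤ R) (q : ∀ n, Z n) :
    Sim (Ultralimit Z q) Y.carrier := by
  constructor
  · refine Precsim.of_eventually h hZ fun N x S ε hS hε => ?_
    choose f hf using fun i => exists_isLimit (x i)
    have hlim : ∀ i j, Tendsto (fun n => edist (f i n) (f j n)) (hyperfilter ℕ)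
        (𝓝 (edist (x i) (x j))) := fun i j => by
      simp only [edist_dist]
      exact ENNReal.tendsto_ofReal ((hf i).tendsto_dist (hf j))
    have hev : ∀ i j, ∀ᶠ n in (hyperfilter ℕ : Filter ℕ),
        min (edist (x i) (x j)) S ≤ edist (f i n) (f j n) + ε := fun i j =>
      (((hlim i j).add_const ε).eventually_const_lt
        (ENNReal.lt_add_right (edist_ne_top _ _) hε)).mono fun n hn => (min_le_left _ _).trans hn.le
    refine Frequently.filter_mono ?_ Nat.hyperfilter_le_atTop
    refine Eventually.frequently ?_
    filter_upwards [eventually_all.mpr fun i => eventually_all.mpr (hev i)] with n hn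
    exact ⟨fun i => f i n, hn⟩
  · refine precsim_of_exists_tupleDom fun N y S ε hS hε => ?_
    have hev := (eventually_exists_tupleDom_memClass h hZ N hS hε).filter_mono
      Nat.hyperfilter_le_atTop
    -- For the exceptional `n` an arbitrary tuple is used.
    have hex : ∀ n, ∃ z : Fin N → Z n,
        (∀ y : Fin N → Y.carrier, ∃ z : Fin N → Z n, TupleDom S ε y z) → TupleDom S ε y z := by
      intro n
      by_cases hn : ∀ y : Fin N → Y.carrier, ∃ z : Fin N → Z n, TupleDom S ε y z
      · exact (hn y).imp fun z hz _ => hz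
      · exact ⟨fun _ => q n, fun h' => absurd h' hn⟩
    choose z hz using hex
    choose x hx using fun i => exists_isLimit_of_bounded (q := q) (fun n => z n i)
      (hR.mono fun n hn => hn _ _)
    refine ⟨x, fun i j => ?_⟩
    have hlim : Tendsto (fun n => edist (z n i) (z n j)) (hyperfilter ℕ)
        (𝓝 (edist (x i) (x j))) := by
      simp only [edist_dist]
      exact ENNReal.tendsto_ofReal ((hx i).tendsto_dist (hx j))
    exact ge_of_tendsto (hlim.add_const ε) (hev.mono fun n hn => hz n hn i j)

theorem tupleDom_of_pairwise {ι W : Type*} {Z : Type v} [EMetricSpace W] [MetricSpace Z]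
    (x : ι → W) {R : ℝ≥0∞} (hR : R ≠ ⊤) (ε : ℝ≥0∞) {z : ι → Z}
    (hz : ∀ i j, i ≠ j → R.toReal ≤ dist (z i) (z j)) : TupleDom R ε x z := by
  intro i j
  rcases eq_or_ne i j with rfl | hij
  · simp
  · refine (min_le_right _ _).trans (le_trans ?_ le_self_add)
    rw [edist_dist]
    exact (ENNReal.le_ofReal_iff_toReal_le hR dist_nonneg).mpr (hz i j hij)

/-- A tuple with pairwise distances at least `R` dominates every tuple truncated at `R`. Such tuples
exist in the line and, on almost geodesics longer than `N * R`, in infinitely many `Z n`. -/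
theorem sim_real {X : ℕ → ExtMetricSpace.{u}} {Y : ExtMetricSpace.{u}}
    (h : Tendsto (fun n => rho (X n) Y) atTop (𝓝 0))
    {Z : ℕ → Type u} [∀ n, MetricSpace (Z n)] (hZ : ∀ n, MemClass (Z n) (X n))
    (hgeo : ∀ n, IsAlmostGeodesic (Z n))
    (hR : ∀ R : ℝ, ∃ᶠ n in atTop, ∃ x y : Z n, R < dist x y) :
    Sim (ULift.{u} ℝ) Y.carrier := by
  have hsep : ∀ {N : ℕ} {i j : Fin N} {a : ℝ}, 0 ≤ a → i ≠ j → a ≤ |(i : ℝ) * a - j * a| := by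
    intro N i j a ha hij
    rw [← sub_mul, abs_mul, abs_of_nonneg ha]
    refine le_mul_of_one_le_left ha ?_
    have h1 : ((i : ℕ) : ℤ) - (j : ℕ) ≠ 0 :=
      sub_ne_zero.mpr (by exact_mod_cast fun e => hij (Fin.ext e))
    exact_mod_cast Int.one_le_abs h1
  constructor
  · refine Precsim.of_eventually h hZ fun N x S ε hS hε => ?_
    refine (hR (N * S.toReal)).mono fun n ⟨a, b, hab⟩ => ?_
    obtain ⟨γ, -, -, hγ⟩ := hgeo n a b 1 one_pos
    refine ⟨fun i => γ (i * S.toReal), tupleDom_of_pairwise x hS ε fun i j hij => ?_⟩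
    have hm : ∀ i : Fin N, (i : ℝ) * S.toReal ∈ Set.Icc 0 (dist a b) := fun i =>
      ⟨by positivity, le_trans (by gcongr; exact i.2.le) hab.le⟩
    exact (hsep ENNReal.toReal_nonneg hij).trans (hγ _ (hm i) _ (hm j)).1
  · refine precsim_of_exists_tupleDom fun N y S ε hS hε => ?_
    refine ⟨fun i => ⟨i * S.toReal⟩, tupleDom_of_pairwise y hS ε fun i j hij => ?_⟩
    exact hsep ENNReal.toReal_nonneg hij

/-- A property of metric spaces that holds for the real line and is inherited by ultralimits is
closed with respect to `ρ`. -/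
theorem exists_memClass_of_tendsto_rho {p : ∀ (Z : Type u) [MetricSpace Z], Prop}
    (hgeo : ∀ (Z : Type u) [MetricSpace Z], p Z → IsAlmostGeodesic Z) (hreal : p (ULift.{u} ℝ))
    (hlim : ∀ (Z : ℕ → Type u) [∀ n, MetricSpace (Z n)] (q : ∀ n, Z n), (∀ n, p (Z n)) →
      p (Ultralimit Z q))
    {X : ℕ → ExtMetricSpace.{u}} {Y : ExtMetricSpace.{u}}
    (h : Tendsto (fun n => rho (X n) Y) atTop (𝓝 0))
    (hX : ∀ n, ∃ (Z : Type u) (_ : MetricSpace Z), MemClass Z (X n) ∧ p Z) :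
    ∃ (Z : Type u) (_ : MetricSpace Z), MemClass Z Y ∧ p Z := by
  choose Z hm hZ hp using hX
  let q : ∀ n, Z n := fun n => (hZ n).1.some
  by_cases hR : ∃ R : ℝ, ∀ᶠ n in (hyperfilter ℕ : Filter ℕ), ∀ x y : Z n, dist x y ≤ R
  · obtain ⟨R, hR⟩ := hR
    exact ⟨Ultralimit Z q, inferInstance, ⟨⟨Ultralimit.base Z q⟩, sim_ultralimit h hZ hR q⟩,
      hlim Z q hp⟩
  · push Not at hR
    refine ⟨ULift.{u} ℝ, inferInstance, ⟨inferInstance, sim_real h hZ (fun n => hgeo _ (hp n))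
      fun R => (hR R).frequently.filter_mono Nat.hyperfilter_le_atTop⟩, hreal⟩

/-! ### Balls in pointed geodesic spaces -/

/-- Each tuple in the closed `r`-ball of `P` that starts at the base point is dominated, up to an
error `ε`, by such a tuple in the closed `s`-ball of `Q`. -/
def BallDom (P Q : PointedGeodesic.{u}) (N : ℕ) (r s ε : ℝ) : Prop :=
  ∀ x : Fin (N + 1) → P.carrier, x 0 = P.pt → (∀ i, dist (x i) P.pt ≤ r) →
    ∃ y : Fin (N + 1) → Q.carrier, y 0 = Q.pt ∧ (∀ i, dist (y i) Q.pt ≤ s) ∧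
      ∀ i j, dist (x i) (x j) ≤ dist (y i) (y j) + ε

section BallDom

variable {P Q W : PointedGeodesic.{u}} {N : ℕ} {r s t ε ε' : ℝ}

theorem BallDom.trans (h : BallDom P Q N r s ε) (h' : BallDom Q W N s t ε') :
    BallDom P W N r t (ε + ε') := by
  intro x hx hxr
  obtain ⟨y, hy, hys, hxy⟩ := h x hx hxr
  obtain ⟨z, hz, hzt, hyz⟩ := h' y hy hys
  exact ⟨z, hz, hzt, fun i j => by linarith [hxy i j, hyz i j]⟩

theorem BallDom.mono {r' : ℝ} (h : BallDom P Q N r s ε) (hr : r' ≤ r) (hε : ε ≤ ε') :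
    BallDom P Q N r' s ε' := by
  intro x hx hxr
  obtain ⟨y, hy, hys, hxy⟩ := h x hx fun i => (hxr i).trans hr
  exact ⟨y, hy, hys, fun i j => by linarith [hxy i j]⟩

/-- A point outside the smaller ball moves along a geodesic towards the base point until it reaches
distance `t`. -/
theorem PointedGeodesic.exists_retract (Q : PointedGeodesic.{u}) (ht : 0 ≤ t) (hts : t ≤ s)
    {y : Q.carrier} (hy : dist y Q.pt ≤ s) :
    ∃ z : Q.carrier, dist z Q.pt ≤ t ∧ dist y z ≤ s - t ∧ (y = Q.pt → z = Q.pt) := by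
  by_cases h : dist y Q.pt ≤ t
  · exact ⟨y, h, by simpa using hts, fun h => h⟩
  · obtain ⟨γ, hγ⟩ := Q.geodesic Q.pt y
    rw [not_le] at h
    have hm : t ∈ Set.Icc 0 (dist Q.pt y) := ⟨ht, by rw [dist_comm]; exact h.le⟩
    refine ⟨γ t, ?_, ?_, fun e => absurd h ?_⟩
    · rw [dist_comm, hγ.dist_left hm]
    · rw [dist_comm, hγ.dist_right hm, dist_comm]
      linarith
    · simpa [e] using ht

theorem BallDom.shrink (h : BallDom P Q N r s ε) (ht : 0 ≤ t) (hts : t ≤ s) :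
    BallDom P Q N r t (ε + 2 * (s - t)) := by
  intro x hx hxr
  obtain ⟨y, hy, hys, hxy⟩ := h x hx hxr
  choose z hz hyz hz0 using fun i => Q.exists_retract ht hts (hys i)
  refine ⟨z, hz0 0 hy, hz, fun i j => ?_⟩
  have h1 := dist_triangle4 (y i) (z i) (z j) (y j)
  rw [dist_comm (z j)] at h1
  linarith [hxy i j, hyz i, hyz j]

theorem pointedBall_edist (P : PointedGeodesic.{u}) (r : ℝ) (hr : 0 < r)
    (x y : (pointedBall P r hr).carrier) : edist x y = ENNReal.ofReal (dist x.1 y.1) :=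
  edist_dist (α := Metric.closedBall P.pt r) x y

theorem scaledBall_edist (P : PointedGeodesic.{u}) (r : ℝ) (hr : 0 < r)
    (x y : (scaledBall P r hr).carrier) : edist x y = ENNReal.ofReal (r⁻¹ * dist x.1 y.1) :=
  (scaledMetric r⁻¹ (inv_pos.mpr hr) (Metric.closedBall P.pt r)).edist_dist x y

theorem tupleDom_pointedBall_iff {ι : Type*} {hr : 0 < r} {R ε : ℝ≥0∞}
    {x : ι → (pointedBall P r hr).carrier} {y : ι → (pointedBall Q r hr).carrier} :
    TupleDom R ε x y ↔ ∀ i j, min (ENNReal.ofReal (dist (x i).1 (x j).1)) R ≤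
      ENNReal.ofReal (dist (y i).1 (y j).1) + ε := by
  simp only [TupleDom, pointedBall_edist]

theorem tupleDom_scaledBall_iff {ι : Type*} {hr : 0 < r} {R ε : ℝ≥0∞}
    {x : ι → (scaledBall P r hr).carrier} {y : ι → (scaledBall Q r hr).carrier} :
    TupleDom R ε x y ↔ ∀ i j, min (ENNReal.ofReal (r⁻¹ * dist (x i).1 (x j).1)) R ≤
      ENNReal.ofReal (r⁻¹ * dist (y i).1 (y j).1) + ε := by
  simp only [TupleDom, scaledBall_edist]

theorem dist_le_two_mul {x y : P.carrier} (hx : dist x P.pt ≤ r) (hy : dist y P.pt ≤ r) :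
    dist x y ≤ 2 * r := by
  linarith [dist_triangle_right x y P.pt]

/-- Distances in the ball are at most `2 * r`, so truncating there loses nothing and real errors
suffice. -/
theorem precsimPt_pointedBall_iff (hr : 0 < r) :
    PrecsimPt (pointedBall P r hr).pt (pointedBall Q r hr).pt ↔
      ∀ (N : ℕ) (ε : ℝ), 0 < ε → BallDom P Q N r r ε := by
  constructor
  · intro h N ε hε x hx hxr
    obtain ⟨y, hy, hxy⟩ := h.exists_tupleDom (X := (pointedBall P r hr).carrier)
      (fun i => ⟨x i, hxr i⟩) (Subtype.ext hx) (R := ENNReal.ofReal (2 * r))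
      (ε := ENNReal.ofReal ε) ENNReal.ofReal_ne_top (ENNReal.ofReal_pos.mpr hε).ne'
    refine ⟨fun i => (y i).1, congrArg Subtype.val hy, fun i => (y i).2, fun i j => ?_⟩
    have : min (ENNReal.ofReal (dist (x i) (x j))) (ENNReal.ofReal (2 * r)) ≤
        ENNReal.ofReal (dist (y i).1 (y j).1) + ENNReal.ofReal ε :=
      tupleDom_pointedBall_iff.mp hxy i j
    rw [min_eq_left
      (ENNReal.ofReal_le_ofReal (dist_le_two_mul (hxr i) (hxr j))),
      ← ENNReal.ofReal_add dist_nonneg hε.le, ENNReal.ofReal_le_ofReal_iff (by positivity)] at this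
    exact this
  · intro h
    refine precsimPt_of_exists_tupleDom fun N x hx R ε _ hε => ?_
    obtain ⟨δ, hδ0, hδ⟩ := ENNReal.lt_iff_exists_nnreal_btwn.mp (pos_iff_ne_zero.mpr hε)
    have hδ0' : (0 : ℝ) < δ := by exact_mod_cast hδ0
    obtain ⟨y, hy, hyr, hxy⟩ := h N δ hδ0' (fun i => (x i).1) (congrArg Subtype.val hx)
      fun i => (x i).2
    refine ⟨fun i => ⟨y i, hyr i⟩, Subtype.ext hy,
      tupleDom_pointedBall_iff.mpr fun i j => (min_le_left _ _).trans ?_⟩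
    refine (ENNReal.ofReal_le_ofReal (hxy i j)).trans ?_
    rw [ENNReal.ofReal_add dist_nonneg hδ0'.le, ENNReal.ofReal_coe_nnreal]
    gcongr

/-- Level `N + 2` leaves room for `N + 1` points and is at least `2`, which bounds the diameter of
the rescaled ball; the truncation is thus inactive. -/
theorem ballDom_of_rhoPtN_lt (hr : 0 < r) {η : ℝ}
    (h : rhoPtN (N + 2) (scaledBall P r hr) (scaledBall Q r hr) < ENNReal.ofReal η) :
    BallDom P Q N r r (3 * η * r) := by
  intro x hx hxr
  have hη : 0 < η := ENNReal.ofReal_pos.mp (bot_le.trans_lt h)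
  obtain ⟨y, hy, hxy⟩ := exists_tupleDom_of_rhoPtN_lt (P := scaledBall P r hr) (N := N)
    (by omega) h (fun i => ⟨x i, hxr i⟩) (Subtype.ext hx)
  refine ⟨fun i => (y i).1, congrArg Subtype.val hy, fun i => (y i).2, fun i j => ?_⟩
  have h1 : min (ENNReal.ofReal (r⁻¹ * dist (x i) (x j))) ((N + 2 : ℕ) : ℝ≥0∞) ≤
      ENNReal.ofReal (r⁻¹ * dist (y i).1 (y j).1) + 3 * ENNReal.ofReal η :=
    tupleDom_scaledBall_iff.mp hxy i j
  have h2 : r⁻¹ * dist (x i) (x j) ≤ 2 := by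
    rw [inv_mul_le_iff₀ hr]
    linarith [dist_le_two_mul (hxr i) (hxr j)]
  have h3 : ENNReal.ofReal (r⁻¹ * dist (x i) (x j)) ≤ ((N + 2 : ℕ) : ℝ≥0∞) := by
    refine (ENNReal.ofReal_le_ofReal h2).trans ?_
    rw [ENNReal.ofReal_ofNat]
    exact_mod_cast Nat.le_add_left 2 N
  rw [min_eq_left h3,
    show (3 : ℝ≥0∞) = ENNReal.ofReal 3 by simp, ← ENNReal.ofReal_mul (by norm_num),
    ← ENNReal.ofReal_add (by positivity) (by positivity),
    ENNReal.ofReal_le_ofReal_iff (by positivity), inv_mul_le_iff₀ hr] at h1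
  calc dist (x i) (x j) ≤ r * (r⁻¹ * dist (y i).1 (y j).1 + 3 * η) := h1
    _ = dist (y i).1 (y j).1 + 3 * η * r := by field_simp

/-- Otherwise the integrand would be at least `c * r * exp (-(r + δ) ^ 2)` on an interval of length
`δ`. Minorizing by an indicator function requires no measurability of `rhoPt` in the radius. -/
theorem exists_rhoPt_lt_of_rho₀_lt (hr : 0 < r) {δ : ℝ} {c : ℝ≥0∞}
    (h : rho₀ P Q < c * ENNReal.ofReal (r * Real.exp (-(r + δ) ^ 2)) * ENNReal.ofReal δ) :
    ∃ (s : ℝ) (hs : 0 < s), s ∈ Set.Ioo r (r + δ) ∧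
      rhoPt (scaledBall P s hs) (scaledBall Q s hs) < c := by
  by_contra! hcon
  refine h.not_ge ?_
  let m := c * ENNReal.ofReal (r * Real.exp (-(r + δ) ^ 2))
  let S : Set (Set.Ioi (0 : ℝ)) := Subtype.val ⁻¹' Set.Ioo r (r + δ)
  have hS : MeasurableSet S := measurable_subtype_coe measurableSet_Ioo
  have hvol : Measure.comap Subtype.val volume S = ENNReal.ofReal δ := by
    rw [(MeasurableEmbedding.subtype_coe measurableSet_Ioi).comap_apply,
      Subtype.image_preimage_coe, Set.inter_eq_right.mpr, Real.volume_Ioo]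
    · congr 1; ring
    · exact fun s hs => hr.trans hs.1
  calc m * ENNReal.ofReal δ
      = ∫⁻ s : Set.Ioi (0 : ℝ), S.indicator (fun _ => m) s
          ∂(Measure.comap Subtype.val volume) := by
        rw [lintegral_indicator_const hS, hvol]
    _ ≤ rho₀ P Q := by
        refine lintegral_mono fun s => Set.indicator_apply_le' (fun hs => ?_) (fun _ => zero_le)
        refine mul_le_mul' (hcon s.1 s.2 hs) (ENNReal.ofReal_le_ofReal ?_)
        have h1 : r < s.1 := hs.1
        have h2 : s.1 < r + δ := hs.2
        refine mul_le_mul h1.le (Real.exp_le_exp.mpr ?_) (Real.exp_pos _).le (hr.trans h1).le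
        nlinarith

theorem eventually_ballDom {X : ℕ → PointedGeodesic.{u}} {Y : PointedGeodesic.{u}}
    (h : Tendsto (fun n => rho₀ (X n) Y) atTop (𝓝 0)) (hr : 0 < r) (N : ℕ) (hε : 0 < ε) :
    ∀ᶠ n in atTop, BallDom (X n) Y N r r ε ∧ BallDom Y (X n) N r r ε := by
  -- With these values the approximation error `3 * η * s` and the shrinking error `2 * (s - r)` are
  -- at most `ε / 2` each.
  let δ := ε / 4
  let η := ε / (6 * (r + δ))
  have hδ : 0 < δ := by positivity
  have hη : 0 < η := by positivity
  have hc : 0 < 2⁻¹ ^ (N + 1 + 1) * ENNReal.ofReal η *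
      ENNReal.ofReal (r * Real.exp (-(r + δ) ^ 2)) * ENNReal.ofReal δ := by
    have := Real.exp_pos (-(r + δ) ^ 2)
    refine ENNReal.mul_pos (mul_ne_zero (mul_ne_zero (pow_ne_zero _ (by simp)) ?_) ?_) ?_ <;>
      exact (ENNReal.ofReal_pos.mpr (by positivity)).ne'
  filter_upwards [h.eventually_lt_const hc] with n hn
  obtain ⟨s, hs0, hs, hlt⟩ := exists_rhoPt_lt_of_rho₀_lt hr hn
  have hN := rhoPtN_lt_of_rhoPt_lt hlt
  have herr : 3 * η * s + 2 * (s - r) ≤ ε := by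
    have h1 : 3 * η * s ≤ 3 * η * (r + δ) := by
      have := hs.2.le
      gcongr
    have h2 : 3 * η * (r + δ) = ε / 2 := by
      simp only [η]
      have : r + δ ≠ 0 := by positivity
      field_simp
      norm_num
    have h3 : 2 * (s - r) ≤ ε / 2 := by
      have := hs.2
      simp only [δ] at this
      linarith
    linarith
  exact ⟨((ballDom_of_rhoPtN_lt hs0 hN).shrink hr.le hs.1.le).mono hs.1.le herr,
    ((ballDom_of_rhoPtN_lt hs0 (rhoPtN_comm _ _ _ ▸ hN)).shrink hr.le hs.1.le).mono hs.1.le herr⟩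

end BallDom

/-! ### Limits of classes in `𝓖₀/≃` -/

theorem StrongEquiv.ballDom {P Q : PointedGeodesic.{u}} (h : StrongEquiv P Q) {r ε : ℝ}
    (hr : 0 < r) (hε : 0 < ε) (N : ℕ) : BallDom P Q N r r ε ∧ BallDom Q P N r r ε :=
  ⟨(precsimPt_pointedBall_iff hr).mp (h r hr).1 N ε hε,
    (precsimPt_pointedBall_iff hr).mp (h r hr).2 N ε hε⟩

theorem StrongEquiv.refl (P : PointedGeodesic.{u}) : StrongEquiv P P := fun _ hr =>
  have h := (precsimPt_pointedBall_iff (P := P) (Q := P) hr).mpr fun _ _ hε x hx hxr =>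
    ⟨x, hx, hxr, fun _ _ => le_add_of_nonneg_right hε.le⟩
  ⟨h, h⟩

/-- The pointed ultralimit of a sequence of pointed geodesic spaces. -/
noncomputable def ultralimitGeodesic (Q : ℕ → PointedGeodesic.{u}) : PointedGeodesic.{u} where
  carrier := Ultralimit (fun n => (Q n).carrier) fun n => (Q n).pt
  geodesic := Ultralimit.isGeodesicSpace fun n => (Q n).geodesic.isAlmostGeodesic
  pt := Ultralimit.base _ _

theorem ballDom_ultralimitGeodesic_left {Q : ℕ → PointedGeodesic.{u}} {Y : PointedGeodesic.{u}}
    {N : ℕ} {r ε : ℝ} (hr : 0 < r) (hε : 0 < ε)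
    (h : ∀ s ε, 0 < s → 0 < ε → ∀ᶠ n in atTop, BallDom (Q n) Y N s s ε) :
    BallDom (ultralimitGeodesic Q) Y N r r ε := by
  intro x hx hxr
  -- Representatives of points of the closed `r`-ball lie only in balls of radius `r + δ`. One `δ`
  -- is lost in the distances, one in the domination, and two in shrinking back to radius `r`.
  let δ := ε / 4
  have hδ : 0 < δ := by positivity
  have hex : ∀ i, ∃ f : ∀ n, (Q n).carrier, IsLimit (q := fun n => (Q n).pt) f (x i) ∧
      (i = 0 → f = fun n => (Q n).pt) := by
    intro i
    by_cases hi : i = 0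
    · exact ⟨fun n => (Q n).pt, by rw [hi, hx]; exact isLimit_base, fun _ => rfl⟩
    · obtain ⟨f, hf⟩ := exists_isLimit (x i)
      exact ⟨f, hf, fun h => absurd h hi⟩
  choose f hf hf0 using hex
  have h1 : ∀ i, ∀ᶠ n in (hyperfilter ℕ : Filter ℕ), dist (f i n) (Q n).pt ≤ r + δ := fun i =>
    ((hf i).tendsto_dist isLimit_base).eventually_le_const
      ((hxr i).trans_lt (lt_add_of_pos_right r hδ))
  have h2 : ∀ i j, ∀ᶠ n in (hyperfilter ℕ : Filter ℕ),
      dist (x i) (x j) - δ ≤ dist (f i n) (f j n) := fun i j =>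
    ((hf i).tendsto_dist (hf j)).eventually_const_le (sub_lt_self _ hδ)
  obtain ⟨n, hn1, hn2, hn3⟩ := ((eventually_all.mpr h1).and
    ((eventually_all.mpr fun i => eventually_all.mpr (h2 i)).and
      ((h (r + δ) δ (by positivity) hδ).filter_mono Nat.hyperfilter_le_atTop))).exists
  obtain ⟨y, hy, hyr, hxy⟩ := hn3.shrink hr.le (by linarith) (fun i => f i n)
    (congrFun (hf0 0 rfl) n) hn1
  refine ⟨y, hy, hyr, fun i j => ?_⟩
  have e1 := hxy i j
  have e2 := hn2 i j
  have e3 : ε = 4 * δ := by simp only [δ]; ring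
  linarith

/-- All conditions on the dominating tuples are closed and pass to the limit without loss in `r` or
`ε`. -/
theorem ballDom_ultralimitGeodesic_right {Q : ℕ → PointedGeodesic.{u}} {Y : PointedGeodesic.{u}}
    {N : ℕ} {r ε : ℝ} (h : ∀ᶠ n in atTop, BallDom Y (Q n) N r r ε) :
    BallDom Y (ultralimitGeodesic Q) N r r ε := by
  intro x hx hxr
  have hex : ∀ n, ∃ y : Fin (N + 1) → (Q n).carrier, BallDom Y (Q n) N r r ε →
      y 0 = (Q n).pt ∧ (∀ i, dist (y i) (Q n).pt ≤ r) ∧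
        ∀ i j, dist (x i) (x j) ≤ dist (y i) (y j) + ε := by
    intro n
    by_cases hn : BallDom Y (Q n) N r r ε
    · exact (hn x hx hxr).imp fun y hy _ => hy
    · exact ⟨fun _ => (Q n).pt, fun h => absurd h hn⟩
  choose y hy using hex
  have hev := (h.filter_mono Nat.hyperfilter_le_atTop).mono hy
  choose z hz using fun i => exists_isLimit_of_bounded (q := fun n => (Q n).pt)
    (fun n => y n i) (hev.mono fun n hn => hn.2.1 i)
  refine ⟨z, ?_, fun i => ?_, fun i j => ?_⟩
  · refine (hz 0).unique_of_tendsto isLimit_base (tendsto_const_nhds.congr' ?_)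
    filter_upwards [hev] with n hn
    rw [hn.1, dist_self]
  · exact le_of_tendsto ((hz i).tendsto_dist isLimit_base) (hev.mono fun n hn => hn.2.1 i)
  · exact ge_of_tendsto (((hz i).tendsto_dist (hz j)).add_const ε)
      (hev.mono fun n hn => hn.2.2 i j)

theorem strongEquiv_ultralimitGeodesic {X Q : ℕ → PointedGeodesic.{u}} {Y : PointedGeodesic.{u}}
    (h : Tendsto (fun n => rho₀ (X n) Y) atTop (𝓝 0)) (hQ : ∀ n, StrongEquiv (Q n) (X n)) :
    StrongEquiv (ultralimitGeodesic Q) Y := by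
  have key : ∀ N s ε, 0 < s → 0 < ε →
      ∀ᶠ n in atTop, BallDom (Q n) Y N s s ε ∧ BallDom Y (Q n) N s s ε := by
    intro N s ε hs hε
    filter_upwards [eventually_ballDom h hs N (half_pos hε)] with n hn
    obtain ⟨h1, h2⟩ := (hQ n).ballDom hs (half_pos hε) N
    exact ⟨(h1.trans hn.1).mono le_rfl (add_halves ε).le,
      (hn.2.trans h2).mono le_rfl (add_halves ε).le⟩
  intro r hr
  refine ⟨(precsimPt_pointedBall_iff hr).mpr fun N ε hε => ?_,
    (precsimPt_pointedBall_iff hr).mpr fun N ε hε => ?_⟩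
  · exact ballDom_ultralimitGeodesic_left hr hε fun s ε hs hε =>
      (key N s ε hs hε).mono fun _ hn => hn.1
  · exact ballDom_ultralimitGeodesic_right ((key N r ε hr hε).mono fun _ hn => hn.2)

end GHCompactification

theorem mainTheorem11 (κ : ℝ) :
    (∀ (X : ℕ → GHCompactification.ExtMetricSpace.{u}) (Y : GHCompactification.ExtMetricSpace.{u}),
      Tendsto (fun n => GHCompactification.rho (X n) Y) atTop (𝓝 0) →
        ((∀ n, GHCompactification.ClassGeodesic (X n)) → GHCompactification.ClassGeodesic Y) ∧
        ((∀ n, GHCompactification.ClassAlexandrovGE κ (X n)) →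
          GHCompactification.ClassAlexandrovGE κ Y) ∧
        ((∀ n, GHCompactification.ClassCAT κ (X n)) → GHCompactification.ClassCAT κ Y)) ∧
    (∀ (X : ℕ → GHCompactification.PointedGeodesic.{u}) (Y : GHCompactification.PointedGeodesic.{u}),
      Tendsto (fun n => GHCompactification.rho₀ (X n) Y) atTop (𝓝 0) →
        ((∀ n, GHCompactification.PtClassGeodesic (X n)) →
          GHCompactification.PtClassGeodesic Y) ∧
        ((∀ n, GHCompactification.PtClassAlexandrovGE κ (X n)) →
          GHCompactification.PtClassAlexandrovGE κ Y) ∧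
        ((∀ n, GHCompactification.PtClassCAT κ (X n)) →
          GHCompactification.PtClassCAT κ Y)) := by
  open GHCompactification in
  refine ⟨fun X Y h => ⟨fun hX => ?_, fun hX => ?_, fun hX => ?_⟩,
    fun X Y h => ⟨fun _ => ⟨Y, StrongEquiv.refl Y, Y.geodesic⟩, fun hX => ?_, fun hX => ?_⟩⟩
  · exact exists_memClass_of_tendsto_rho (p := fun Z _ => IsGeodesicSpace Z)
      (fun Z _ hZ => hZ.isAlmostGeodesic) isGeodesicSpace_real
      (fun Z _ q hZ => Ultralimit.isGeodesicSpace fun n => (hZ n).isAlmostGeodesic) h hX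
  · exact exists_memClass_of_tendsto_rho (p := fun Z _ => IsAlexandrovGE κ Z)
      (fun Z _ hZ => hZ.2.1.isAlmostGeodesic) (isAlexandrovGE_real κ)
      (fun Z _ q hZ => Ultralimit.isAlexandrovGE hZ) h hX
  · exact exists_memClass_of_tendsto_rho (p := fun Z _ => IsCAT κ Z)
      (fun Z _ hZ => hZ.1.isAlmostGeodesic) (isCAT_real κ)
      (fun Z _ q hZ => Ultralimit.isCAT hZ) h hX
  · choose Q hQ hp using hX
    exact ⟨ultralimitGeodesic Q, strongEquiv_ultralimitGeodesic h hQ,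
      Ultralimit.isAlexandrovGE (Y := fun n => (Q n).carrier) hp⟩
  · choose Q hQ hp using hX
    exact ⟨ultralimitGeodesic Q, strongEquiv_ultralimitGeodesic h hQ,
      Ultralimit.isCAT (Y := fun n => (Q n).carrier) hp⟩
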